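/- Conventions. Hilbert spaces are complex, inner products are linear in the second variable, and $[Y]$ denotes the closed linear span of $Y$. A $C^*$-base is a triple $(\mathfrak H,\mathfrak B,\mathfrak B^\dagger)$ consisting of a Hilbert space and two commuting nondegenerate $C^*$-algebras $\mathfrak B,\mathfrak B^\dagger\subseteq\mathcal L(\mathfrak H)$; its opposite is $(\mathfrak H,\mathfrak B^\dagger,\mathfrak B)$. A $C^*$-factorization of a Hilbert space $H$ with respect to $(\mathfrak H,\mathfrak B,\mathfrak B^\dagger)$ is a closed subspace $\alpha\subseteq\mathcal L(\mathfrak H,H)$ with $[\alpha^*\alpha]=\mathfrak B$, $[\alpha\mathfrak B]=\alpha$ and $[\alpha\mathfrak H]=H$; it induces a representation $\rho_\alpha\colon\mathfrak B^\dagger\to\mathcal L(H)$ by $\rho_\alpha(b)\xi\zeta=\xi b\zeta$ ($\xi\in\alpha$, $\zeta\in\mathfrak H$). A $C^*$-bimodule ${}_\beta H_\alpha$ over $(\mathfrak H,\mathfrak B,\mathfrak B^\dagger)$ is a Hilbert space $H$ with a $C^*$-factorization $\alpha$ with respect to $(\mathfrak H,\mathfrak B,\mathfrak B^\dagger)$ and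 a $C^*$-factorization $\beta$ with respect to $(\mathfrak H,\mathfrak B^\dagger,\mathfrak B)$ that are compatible, i.e. $[\rho_\alpha(\mathfrak B^\dagger)\beta]=\beta$ and $[\rho_\beta(\mathfrak B)\alpha]=\alpha$. A morphism ${}_\beta H_\alpha\to{}_\delta K_\gamma$ is an operator $T\in\mathcal L(H,K)$ with $T\alpha\subseteq\gamma$, $T^*\gamma\subseteq\alpha$, $T\beta\subseteq\delta$, $T^*\delta\subseteq\beta$. Given ${}_\beta H_\alpha$ and ${}_\delta K_\gamma$, let $H\,{}_\alpha\!\otimes_\delta K$ be the separated completion of the algebraic tensor product $\alpha\odot\mathfrak H\odot\delta$ with respect to $$\langle\xi\otimes\zeta\otimes\eta\,|\,\xi'\otimes\zeta'\otimes\eta'\rangle=\langle\zeta\,|\,(\xi^*\xi')(\eta^*\eta')\zeta'\rangle .$$ For $\xi\in\alpha$ let $|\xi\rangle_1\colon K\to H\,{}_\alpha\!\otimes_\delta K$ be the bounded operator $\eta\zeta\mapsto\xi\otimes\zeta\otimes\eta$, and for $\eta\in\delta$ let $|\eta\rangle_2\colon H\to H\,{}_\alpha\!\otimes_\delta K$ be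 the bounded operator $\xi\zeta\mapsto\xi\otimes\zeta\otimes\eta$. Put $\beta\triangleleft\delta=[\,|\delta\rangle_2\,\beta\,]$ and $\alpha\triangleright\gamma=[\,|\alpha\rangle_1\,\gamma\,]$. Theorem. For every $C^*$-base $(\mathfrak H,\mathfrak B,\mathfrak B^\dagger)$, the category of $C^*$-bimodules over it carries a structure of a monoidal category such that: (i) the product of objects is ${}_\beta H_\alpha\odot{}_\delta K_\gamma={}_{\beta\triangleleft\delta}(H\,{}_\alpha\!\otimes_\delta K)_{\alpha\triangleright\gamma}$, and the product of morphisms is $S\odot T=S\otimes T\colon \xi\otimes\zeta\otimes\eta\mapsto S\xi\otimes\zeta\otimes T\eta$; (ii) the unit is ${}_{\mathfrak B^\dagger}\mathfrak H_{\mathfrak B}$; (iii) for all ${}_\beta H_\alpha$, ${}_\delta K_\gamma$, ${}_\phi L_\epsilon$, the associator $a\colon (H\,{}_\alpha\!\otimes_\delta K)\,{}_{\alpha\triangleright\gamma}\!\otimes_\phi L\to H\,{}_\alpha\!\otimes_{\delta\triangleleft\phi}(K\,{}_\gamma\!\otimes_\phi L)$ is the unitary with $a\,|\vartheta\rangle_2|\xi\rangle_1k=|\xi\rangle_1|\vartheta\rangle_2k$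 for all $\xi\in\alpha$, $k\in K$, $\vartheta\in\phi$; (iv) for every ${}_\beta H_\alpha$, the unitors $l\colon\mathfrak H\,{}_{\mathfrak B}\!\otimes_\beta H\to H$ and $r\colon H\,{}_\alpha\!\otimes_{\mathfrak B^\dagger}\mathfrak H\to H$ are the unitaries with $l(b\otimes\zeta\otimes\xi)=\xi b\zeta$ for $b\in\mathfrak B$, $\zeta\in\mathfrak H$, $\xi\in\beta$, and $r(\xi\otimes\zeta\otimes b^\dagger)=\xi b^\dagger\zeta$ for $\xi\in\alpha$, $\zeta\in\mathfrak H$, $b^\dagger\in\mathfrak B^\dagger$. -/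

import Mathlib

universe u

open scoped TensorProduct InnerProductSpace

noncomputable section

/-- The closed linear span `[Y]` of a subset `Y` of a normed space. -/
def cspan {E : Type*} [NormedAddCommGroup E] [NormedSpace ℂ E] (Y : Set E) : Submodule ℂ E :=
  (Submodule.span ℂ Y).topologicalClosure

namespace CRel

section Aux

variable {𝔥 : Type*} [NormedAddCommGroup 𝔥] [InnerProductSpace ℂ 𝔥] [CompleteSpace 𝔥]
variable {H : Type*} [NormedAddCommGroup H] [InnerProductSpace ℂ H] [CompleteSpace H]
variable {K : Type*} [NormedAddCommGroup K] [InnerProductSpace ℂ K] [CompleteSpace K]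
variable {V : Type*} [NormedAddCommGroup V] [InnerProductSpace ℂ V]
variable {W : Type*} [NormedAddCommGroup W] [InnerProductSpace ℂ W] [CompleteSpace W]

lemma proj_adjoint {ι : Type*} [Fintype ι] [DecidableEq ι] (i : ι) (v : 𝔥) :
    (PiLp.proj 2 (𝕜 := ℂ) (fun _ : ι => 𝔥) i).adjoint v = PiLp.single 2 i v := by
  apply ext_inner_right ℂ
  intro w
  rw [ContinuousLinearMap.adjoint_inner_left]
  rw [PiLp.inner_apply, Finset.sum_eq_single i] <;>
    simp +contextual [PiLp.proj_apply]

lemma sum_proj {ι : Type*} [Fintype ι] [DecidableEq ι] (v : PiLp 2 (fun _ : ι => 𝔥)) :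
    ∑ i, (PiLp.proj 2 (𝕜 := ℂ) (fun _ : ι => 𝔥) i).adjoint
      (PiLp.proj 2 (𝕜 := ℂ) (fun _ : ι => 𝔥) i v) = v := by
  apply PiLp.ext; intro j
  simp only [proj_adjoint]
  rw [WithLp.ofLp_sum, Finset.sum_apply, Finset.sum_eq_single j] <;>
    simp +contextual [PiLp.proj_apply, eq_comm]

lemma exists_sqrt (S : H →L[ℂ] H) (hS : 0 ≤ S) :
    ∃ R : H →L[ℂ] H, R * R = S ∧ R.adjoint = R ∧ ∀ D, Commute S D → Commute R D :=
  ⟨CFC.sqrt S, CFC.sqrt_mul_sqrt_self S hS,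
    (IsSelfAdjoint.of_nonneg (CFC.sqrt_nonneg S)).star_eq, fun _ h => h.cfcₙ_nnreal _⟩

lemma kernel_nonneg {ι : Type*} [Fintype ι] (x : ι → 𝔥 →L[ℂ] H) (y : ι → 𝔥 →L[ℂ] K)
    (hc : ∀ i j k l, Commute ((x i).adjoint ∘L x j) ((y k).adjoint ∘L y l)) (ζ : ι → 𝔥) :
    0 ≤ (∑ i, ∑ j, ⟪x i (ζ i), x j (((y i).adjoint ∘L y j) (ζ j))⟫_ℂ).re := by
  classical
  have hsum := sum_proj (𝔥 := 𝔥) (ι := ι)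
  have hπe : ∀ i j (v : 𝔥), (PiLp.proj 2 (𝕜 := ℂ) (fun _ : ι => 𝔥) i)
      ((PiLp.proj 2 (𝕜 := ℂ) (fun _ : ι => 𝔥) j).adjoint v) = if i = j then v else 0 := by
    intro i j v
    rw [proj_adjoint, PiLp.proj_apply, PiLp.single_apply]
  obtain ⟨π, hπ⟩ : ∃ π, π = fun i => PiLp.proj 2 (𝕜 := ℂ) (fun _ : ι => 𝔥) i := ⟨_, rfl⟩
  have hπ' : ∀ i, PiLp.proj 2 (𝕜 := ℂ) (fun _ : ι => 𝔥) i = π i := fun i => by rw [hπ]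
  simp only [hπ'] at hsum hπe
  clear hπ hπ'
  obtain ⟨X, hX⟩ : ∃ X, X = ∑ i, x i ∘L π i := ⟨_, rfl⟩
  have hXe : ∀ i v, X ((π i).adjoint v) = x i v := by
    intro i v
    rw [hX, _root_.sum_apply, Finset.sum_eq_single i]
    · simp [hπe]
    · intro j _ hj; simp [hπe, hj]
    · simp
  obtain ⟨S, hS⟩ : ∃ S, S = X.adjoint ∘L X := ⟨_, rfl⟩
  have hS0 : 0 ≤ S := by
    rw [hS, ContinuousLinearMap.nonneg_iff_isPositive]
    exact ContinuousLinearMap.isPositive_adjoint_comp_self X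
  have hext : ∀ u v : PiLp 2 (fun _ : ι => 𝔥), (∀ i, π i u = π i v) → u = v := by
    intro u v h
    rw [← hsum u, ← hsum v]
    simp only [h]
  have hπX : ∀ i w, π i (X.adjoint w) = (x i).adjoint w := by
    intro i w
    refine ext_inner_left ℂ fun v => ?_
    rw [ContinuousLinearMap.adjoint_inner_right, ← hXe,
      ← ContinuousLinearMap.adjoint_inner_right X, ContinuousLinearMap.adjoint_inner_left]
  -- the diagonal operators commute with `S`
  have hD : ∀ k l, ∃ D : PiLp 2 (fun _ : ι => 𝔥) →L[ℂ] PiLp 2 (fun _ : ι => 𝔥),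
      (∀ i v, π i (D v) = ((y k).adjoint ∘L y l) (π i v)) ∧
      (∀ i v, D ((π i).adjoint v) = (π i).adjoint (((y k).adjoint ∘L y l) v)) ∧
      Commute S D := by
    intro k l
    obtain ⟨T, hT⟩ : ∃ T, T = (y k).adjoint ∘L y l := ⟨_, rfl⟩
    have h1 : ∀ i v, π i ((∑ i, (π i).adjoint ∘L T ∘L π i) v) = T (π i v) := by
      intro i v
      rw [_root_.sum_apply, map_sum, Finset.sum_eq_single i]
      · simp [hπe]
      · intro j _ hj; simp [hπe, hj.symm]
      · simp
    have h2 : ∀ i v, (∑ i, (π i).adjoint ∘L T ∘L π i) ((π i).adjoint v) =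
        (π i).adjoint (T v) := by
      intro i v
      refine hext _ _ fun j => ?_
      rw [h1, hπe, hπe]
      split_ifs <;> simp
    rw [← hT]
    refine ⟨∑ i, (π i).adjoint ∘L T ∘L π i, h1, h2, ?_⟩
    refine ContinuousLinearMap.ext fun v => ?_
    rw [← hsum v, map_sum, map_sum]
    refine Finset.sum_congr rfl fun j _ => hext _ _ fun i => ?_
    rw [mul_apply_eq_comp, mul_apply_eq_comp, h1, h2, hS]
    simp only [ContinuousLinearMap.comp_apply, hXe, hπX]
    have := hc i j k l
    rw [← hT] at this
    exact congrArg (fun A => A (π j v)) this.eq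
  obtain ⟨R, hRR, hRs, hRc⟩ := exists_sqrt S hS0
  have hkey : ∀ k i j v, π k (R ((π j).adjoint (((y i).adjoint ∘L y j) v))) =
      ((y i).adjoint ∘L y j) (π k (R ((π j).adjoint v))) := by
    intro k i j v
    obtain ⟨D, h1, h2, h3⟩ := hD i j
    have h4 : Commute R D := hRc D h3
    rw [← h1, ← h2]
    exact congrArg (fun A => π k (A ((π j).adjoint v))) h4.eq
  have hin : ∀ u v : PiLp 2 (fun _ : ι => 𝔥), ⟪u, v⟫_ℂ = ∑ k, ⟪π k u, π k v⟫_ℂ := by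
    intro u v
    conv_lhs => rw [← hsum v]
    simp only [inner_sum, ContinuousLinearMap.adjoint_inner_right]
  have hterm : ∀ i j, ⟪x i (ζ i), x j (((y i).adjoint ∘L y j) (ζ j))⟫_ℂ =
      ∑ k, ⟪y i (π k (R ((π i).adjoint (ζ i)))), y j (π k (R ((π j).adjoint (ζ j))))⟫_ℂ := by
    intro i j
    rw [← hXe, ← hXe, ← ContinuousLinearMap.adjoint_inner_right, ← ContinuousLinearMap.comp_apply,
      ← hS, ← hRR, mul_apply_eq_comp]
    nth_rewrite 1 [← hRs]
    rw [ContinuousLinearMap.adjoint_inner_right, hin]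
    refine Finset.sum_congr rfl fun k _ => ?_
    rw [hkey, ContinuousLinearMap.comp_apply, ContinuousLinearMap.adjoint_inner_right]
  simp only [hterm]
  have : ∑ i, ∑ j, ∑ k, ⟪y i (π k (R ((π i).adjoint (ζ i)))),
      y j (π k (R ((π j).adjoint (ζ j))))⟫_ℂ =
      ∑ k, ⟪∑ i, y i (π k (R ((π i).adjoint (ζ i)))), ∑ i, y i (π k (R ((π i).adjoint (ζ i))))⟫_ℂ := by
    simp only [sum_inner, inner_sum]
    rw [Finset.sum_comm]
    conv_lhs => enter [2, i]; rw [Finset.sum_comm]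
    rw [Finset.sum_comm]
  rw [this, Complex.re_sum]
  exact Finset.sum_nonneg fun k _ => inner_self_nonneg (𝕜 := ℂ)

/-- Bounded extension from a total family. -/
lemma exists_extend {ι : Type*} (v : ι → V) (w : ι → W) (hv : cspan (Set.range v) = ⊤)
    (C : ℝ) (hC : 0 ≤ C) (x : ι → 𝔥 →L[ℂ] H) (y : ι → 𝔥 →L[ℂ] K) (ζ : ι → 𝔥)
    (hc : ∀ i j k l, Commute ((x i).adjoint ∘L x j) ((y k).adjoint ∘L y l))
    (hk : ∀ i j, C ^ 2 * ⟪v i, v j⟫_ℂ - ⟪w i, w j⟫_ℂ =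
      ⟪x i (ζ i), x j (((y i).adjoint ∘L y j) (ζ j))⟫_ℂ) :
    ∃ T : V →L[ℂ] W, (∀ i, T (v i) = w i) ∧ ‖T‖ ≤ C := by
  classical
  have hd : DenseRange (Finsupp.linearCombination ℂ v) := by
    rw [DenseRange, ← LinearMap.coe_range, Finsupp.range_linearCombination, dense_iff_closure_eq,
      ← Submodule.topologicalClosure_coe]
    exact congrArg SetLike.coe hv
  have hb : ∀ f : ι →₀ ℂ, ‖Finsupp.linearCombination ℂ w f‖ ≤
      C * ‖Finsupp.linearCombination ℂ v f‖ := by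
    intro f
    refine le_of_sq_le_sq ?_ (by positivity)
    have h0 := kernel_nonneg (ι := f.support) (fun i => x i) (fun i => y i)
      (fun i j k l => hc _ _ _ _) (fun i => f i • ζ i)
    have h1 : ∑ i : f.support, ∑ j : f.support,
        ⟪x i (f i • ζ i), x j (((y i).adjoint ∘L y j) (f j • ζ j))⟫_ℂ =
        C ^ 2 * ⟪Finsupp.linearCombination ℂ v f, Finsupp.linearCombination ℂ v f⟫_ℂ -
        ⟪Finsupp.linearCombination ℂ w f, Finsupp.linearCombination ℂ w f⟫_ℂ := by
      simp only [Finsupp.linearCombination_apply, Finsupp.sum, ← Finset.sum_coe_sort f.support]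
      simp only [sum_inner, inner_sum, Finset.mul_sum, ← Finset.sum_sub_distrib, map_smul,
        inner_smul_left, inner_smul_right, ← hk]
      rw [Finset.sum_comm]
      refine Finset.sum_congr rfl fun i _ => Finset.sum_congr rfl fun j _ => ?_
      ring
    rw [h1, inner_self_eq_norm_sq_to_K, inner_self_eq_norm_sq_to_K] at h0
    have h2 : 0 ≤ ((C ^ 2 * ‖Finsupp.linearCombination ℂ v f‖ ^ 2 -
        ‖Finsupp.linearCombination ℂ w f‖ ^ 2 : ℝ) : ℂ).re := by
      push_cast; exact h0
    rw [Complex.ofReal_re] at h2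
    rw [mul_pow]
    linarith
  refine ⟨(Finsupp.linearCombination ℂ w).extendOfNorm (Finsupp.linearCombination ℂ v),
    fun i => ?_, LinearMap.opNorm_extendOfNorm_le hd hC hb⟩
  have := LinearMap.extendOfNorm_eq hd ⟨C, hb⟩ (Finsupp.single i 1)
  simpa using this

lemma exists_extend_family {ι M : Type*} [NormedAddCommGroup M] [NormedSpace ℂ M]
    (v : ι → V) (hv : cspan (Set.range v) = ⊤) (w : M →ₗ[ℂ] (ι → W))
    (h : ∀ m, ∃ T : V →L[ℂ] W, (∀ i, T (v i) = w m i) ∧ ‖T‖ ≤ ‖m‖) :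
    ∃ G : M →L[ℂ] V →L[ℂ] W, ∀ m i, G m (v i) = w m i := by
  choose T hT hn using h
  have hext : ∀ A B : V →L[ℂ] W, (∀ i, A (v i) = B (v i)) → A = B := by
    intro A B hAB
    refine ContinuousLinearMap.ext_on (s := Set.range v) ?_ ?_
    · rw [dense_iff_closure_eq, ← Submodule.topologicalClosure_coe]
      exact congrArg SetLike.coe hv
    · rintro _ ⟨i, rfl⟩; exact hAB i
  let G₀ : M →ₗ[ℂ] V →L[ℂ] W :=
    { toFun := T
      map_add' := fun a b => hext _ _ fun i => by simp [hT]
      map_smul' := fun c a => hext _ _ fun i => by simp [hT] }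
  refine ⟨G₀.mkContinuous 1 fun m => by
    rw [one_mul]; exact hn m, fun m i => hT m i⟩

/-- The defect operator of a bounded operator. -/
lemma exists_defect (T : 𝔥 →L[ℂ] H) : ∃ R : 𝔥 →L[ℂ] 𝔥,
    R.adjoint ∘L R = ((‖T‖ : ℂ) ^ 2) • ContinuousLinearMap.id ℂ 𝔥 - T.adjoint ∘L T := by
  obtain ⟨R, h1, h2, -⟩ := exists_sqrt
    (((‖T‖ : ℂ) ^ 2) • ContinuousLinearMap.id ℂ 𝔥 - T.adjoint ∘L T) (by
      rw [ContinuousLinearMap.nonneg_iff_isPositive, ContinuousLinearMap.isPositive_def']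
      constructor
      · rw [IsSelfAdjoint, ContinuousLinearMap.star_eq_adjoint]
        refine ContinuousLinearMap.ext fun v => ext_inner_left ℂ fun w => ?_
        rw [ContinuousLinearMap.adjoint_inner_right]
        simp [inner_sub_left, inner_sub_right, inner_smul_left, inner_smul_right,
          ContinuousLinearMap.adjoint_inner_left, ContinuousLinearMap.adjoint_inner_right]
      · intro v
        simp only [ContinuousLinearMap.reApplyInnerSelf_apply, sub_apply,
          smul_apply, ContinuousLinearMap.id_apply,
          ContinuousLinearMap.comp_apply, inner_sub_left, inner_smul_left,
          ContinuousLinearMap.adjoint_inner_left]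
        rw [inner_self_eq_norm_sq_to_K, inner_self_eq_norm_sq_to_K]
        have h0 : 0 ≤ (((‖T‖ * ‖v‖) ^ 2 - ‖T v‖ ^ 2 : ℝ) : ℂ).re := by
          rw [Complex.ofReal_re]
          have := pow_le_pow_left₀ (norm_nonneg _) (T.le_opNorm v) 2
          linarith
        push_cast at h0
        rw [mul_pow] at h0
        simpa using h0)
  exact ⟨R, by rw [h2]; exact h1⟩

lemma cspan_le {E : Type*} [NormedAddCommGroup E] [NormedSpace ℂ E] {Y : Set E}
    {N : Submodule ℂ E} (hN : IsClosed (N : Set E)) (h : Y ⊆ N) : cspan Y ≤ N :=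
  Submodule.topologicalClosure_minimal _ (Submodule.span_le.2 h) hN

lemma subset_cspan {E : Type*} [NormedAddCommGroup E] [NormedSpace ℂ E] {Y : Set E} {y : E}
    (h : y ∈ Y) : y ∈ cspan Y :=
  Submodule.le_topologicalClosure _ (Submodule.subset_span h)

lemma isClosed_cspan {E : Type*} [NormedAddCommGroup E] [NormedSpace ℂ E] (Y : Set E) :
    IsClosed (cspan Y : Set E) := Submodule.isClosed_topologicalClosure _

/-- A continuous (semi)linear map sends `[Y]` into every closed subspace containing the
image of `Y`. -/
lemma cspan_map {σ : ℂ →+* ℂ} {E F : Type*} [NormedAddCommGroup E] [NormedSpace ℂ E]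
    [NormedAddCommGroup F] [NormedSpace ℂ F] (f : E →SL[σ] F) {Y : Set E} {N : Submodule ℂ F}
    (hN : IsClosed (N : Set F)) (h : ∀ y ∈ Y, f y ∈ N) {y : E} (hy : y ∈ cspan Y) : f y ∈ N := by
  have : cspan Y ≤ N.comap f.toLinearMap :=
    cspan_le (hN.preimage f.continuous) fun y hy => h y hy
  exact this hy

end Aux
end CRel

open CRel

/-- A `C*`-base `(𝔥, 𝔅, 𝔅†)`: two commuting nondegenerate (concrete) `C*`-algebras on a
Hilbert space `𝔥`. -/
structure CStarBase (𝔥 : Type u) [NormedAddCommGroup 𝔥] [InnerProductSpace ℂ 𝔥]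
    [CompleteSpace 𝔥] where
  /-- the algebra `𝔅` -/
  alg : NonUnitalStarSubalgebra ℂ (𝔥 →L[ℂ] 𝔥)
  /-- the algebra `𝔅†` -/
  dual : NonUnitalStarSubalgebra ℂ (𝔥 →L[ℂ] 𝔥)
  isClosed_alg : IsClosed (alg : Set (𝔥 →L[ℂ] 𝔥))
  isClosed_dual : IsClosed (dual : Set (𝔥 →L[ℂ] 𝔥))
  alg_nondegenerate : cspan {z : 𝔥 | ∃ b ∈ alg, ∃ ζ : 𝔥, b ζ = z} = ⊤
  dual_nondegenerate : cspan {z : 𝔥 | ∃ b ∈ dual, ∃ ζ : 𝔥, b ζ = z} = ⊤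
  commute : ∀ b ∈ alg, ∀ c ∈ dual, Commute b c

/-- The opposite base `(𝔥, 𝔅†, 𝔅)`. -/
abbrev CStarBase.op {𝔥 : Type u} [NormedAddCommGroup 𝔥] [InnerProductSpace ℂ 𝔥]
    [CompleteSpace 𝔥] (𝔅 : CStarBase 𝔥) : CStarBase 𝔥 where
  alg := 𝔅.dual
  dual := 𝔅.alg
  isClosed_alg := 𝔅.isClosed_dual
  isClosed_dual := 𝔅.isClosed_alg
  alg_nondegenerate := 𝔅.dual_nondegenerate
  dual_nondegenerate := 𝔅.alg_nondegenerate
  commute b hb c hc := (𝔅.commute c hc b hb).symm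

/-- A `C*`-factorization of a Hilbert space `H` with respect to `(𝔥, 𝔅, 𝔅†)`: a closed subspace
`α ⊆ L(𝔥, H)` with `[α* α] = 𝔅`, `[α 𝔅] = α` and `[α 𝔥] = H`. -/
structure CFact {𝔥 : Type u} [NormedAddCommGroup 𝔥] [InnerProductSpace ℂ 𝔥] [CompleteSpace 𝔥]
    (𝔅 : CStarBase 𝔥) (H : Type u) [NormedAddCommGroup H] [InnerProductSpace ℂ H]
    [CompleteSpace H] where
  space : Submodule ℂ (𝔥 →L[ℂ] H)
  isClosed_space : IsClosed (space : Set (𝔥 →L[ℂ] H))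
  adjoint_mul : cspan {c : 𝔥 →L[ℂ] 𝔥 | ∃ ξ ∈ space, ∃ ξ' ∈ space, ξ.adjoint ∘L ξ' = c} =
    𝔅.alg.toSubmodule
  mul_alg : cspan {ξ' : 𝔥 →L[ℂ] H | ∃ ξ ∈ space, ∃ b ∈ 𝔅.alg, ξ ∘L b = ξ'} = space
  total : cspan {z : H | ∃ ξ ∈ space, ∃ ζ : 𝔥, ξ ζ = z} = ⊤

namespace CFact

variable {𝔥 : Type u} [NormedAddCommGroup 𝔥] [InnerProductSpace ℂ 𝔥] [CompleteSpace 𝔥]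
  {𝔨 : Type u} [NormedAddCommGroup 𝔨] [InnerProductSpace ℂ 𝔨] [CompleteSpace 𝔨]
  {𝔅 : CStarBase 𝔥} {ℭ : CStarBase 𝔨}
  {H : Type u} [NormedAddCommGroup H] [InnerProductSpace ℂ H] [CompleteSpace H]
  {K : Type u} [NormedAddCommGroup K] [InnerProductSpace ℂ K] [CompleteSpace K]

open CRel

lemma adjoint_mul_mem (α : CFact 𝔅 H) {ξ ξ' : 𝔥 →L[ℂ] H} (h : ξ ∈ α.space) (h' : ξ' ∈ α.space) :
    ξ.adjoint ∘L ξ' ∈ 𝔅.alg := by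
  have : ξ.adjoint ∘L ξ' ∈ 𝔅.alg.toSubmodule := by
    rw [← α.adjoint_mul]; exact subset_cspan ⟨ξ, h, ξ', h', rfl⟩
  exact this

lemma mul_mem (α : CFact 𝔅 H) {ξ : 𝔥 →L[ℂ] H} (h : ξ ∈ α.space) {b : 𝔥 →L[ℂ] 𝔥}
    (hb : b ∈ 𝔅.alg) : ξ ∘L b ∈ α.space := by
  have : ξ ∘L b ∈ cspan {ξ' : 𝔥 →L[ℂ] H | ∃ ξ ∈ α.space, ∃ b ∈ 𝔅.alg, ξ ∘L b = ξ'} :=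
    subset_cspan ⟨ξ, h, b, hb, rfl⟩
  rwa [α.mul_alg] at this

lemma total_range (α : CFact 𝔅 H) :
    cspan (Set.range fun i : α.space × 𝔥 => (i.1 : 𝔥 →L[ℂ] H) i.2) = ⊤ := by
  rw [← α.total]
  congr 1
  ext z
  simp

/-- Bounded operators which agree on `α 𝔥` are equal. -/
lemma ext_op {V : Type*} [NormedAddCommGroup V] [InnerProductSpace ℂ V]
    (α : CFact 𝔅 H) {A B : H →L[ℂ] V}
    (h : ∀ ξ ∈ α.space, ∀ ζ, A (ξ ζ) = B (ξ ζ)) : A = B := by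
  refine ContinuousLinearMap.ext_on
    (s := Set.range fun i : α.space × 𝔥 => (i.1 : 𝔥 →L[ℂ] H) i.2) ?_ ?_
  · rw [dense_iff_closure_eq, ← Submodule.topologicalClosure_coe]
    exact congrArg SetLike.coe α.total_range
  · rintro _ ⟨i, rfl⟩; exact h _ i.1.2 _

lemma exists_rho (α : CFact 𝔅 H) : ∃ G : 𝔅.dual.toSubmodule →L[ℂ] H →L[ℂ] H,
    ∀ b, ∀ ξ ∈ α.space, ∀ ζ, G b (ξ ζ) = ξ ((b : 𝔥 →L[ℂ] 𝔥) ζ) := by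
  obtain ⟨G, hG⟩ := exists_extend_family (M := 𝔅.dual.toSubmodule)
    (fun i : α.space × 𝔥 => (i.1 : 𝔥 →L[ℂ] H) i.2) α.total_range
    (W := H)
    { toFun := fun b i => (i.1 : 𝔥 →L[ℂ] H) ((b : 𝔥 →L[ℂ] 𝔥) i.2)
      map_add' := fun a b => by ext i; simp
      map_smul' := fun c b => by ext i; simp } (by
      rintro ⟨b, hb⟩
      obtain ⟨R, hR⟩ := exists_defect b
      replace hb : b ∈ 𝔅.dual := hb
      have hbb : b.adjoint ∘L b ∈ 𝔅.dual := MulMemClass.mul_mem (star_mem hb) hb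
      refine exists_extend _ _ α.total_range ‖b‖ (norm_nonneg _) (fun i => (i.1 : 𝔥 →L[ℂ] H))
        (fun _ => R) (fun i => i.2) ?_ ?_
      · intro i j _ _
        rw [hR]
        refine Commute.sub_right ?_ (𝔅.commute _ (α.adjoint_mul_mem i.1.2 j.1.2) _ hbb)
        exact (Commute.one_right _).smul_right _
      · intro i j
        rw [hR]
        have hc := 𝔅.commute _ (α.adjoint_mul_mem i.1.2 j.1.2) _ hb
        have hc' : ∀ z, ((i.1 : 𝔥 →L[ℂ] H).adjoint) ((j.1 : 𝔥 →L[ℂ] H) (b z)) =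
            b (((i.1 : 𝔥 →L[ℂ] H).adjoint) ((j.1 : 𝔥 →L[ℂ] H) z)) := fun z =>
          congrArg (fun A => A z) hc.eq
        have hs := 𝔅.commute _ (α.adjoint_mul_mem i.1.2 j.1.2) _ (star_mem hb)
        have hs' : ∀ z, ((i.1 : 𝔥 →L[ℂ] H).adjoint) ((j.1 : 𝔥 →L[ℂ] H) (b.adjoint z)) =
            b.adjoint (((i.1 : 𝔥 →L[ℂ] H).adjoint) ((j.1 : 𝔥 →L[ℂ] H) z)) := fun z =>
          congrArg (fun A => A z) hs.eq
        simp only [sub_apply, smul_apply, ContinuousLinearMap.id_apply, map_sub, map_smul,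
          inner_sub_right, inner_smul_right, ContinuousLinearMap.comp_apply, LinearMap.coe_mk,
          AddHom.coe_mk]
        congr 1
        rw [← ContinuousLinearMap.adjoint_inner_right (i.1 : 𝔥 →L[ℂ] H), hc',
          ← ContinuousLinearMap.adjoint_inner_right (i.1 : 𝔥 →L[ℂ] H), hs',
          ← ContinuousLinearMap.adjoint_inner_right b, ← hc'])
  exact ⟨G, fun b ξ hξ ζ => hG b (⟨ξ, hξ⟩, ζ)⟩

/-- The representation `ρ_α : 𝔅† → L(H)`, determined by `ρ_α(b) ξ ζ = ξ b ζ` for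
`ξ ∈ α`, `ζ ∈ 𝔥`. -/
def rho (α : CFact 𝔅 H) : 𝔅.dual.toSubmodule →L[ℂ] H →L[ℂ] H := Classical.choose α.exists_rho

lemma rho_apply (α : CFact 𝔅 H) (b : 𝔅.dual.toSubmodule) {ξ : 𝔥 →L[ℂ] H} (hξ : ξ ∈ α.space)
    (ζ : 𝔥) : α.rho b (ξ ζ) = ξ ((b : 𝔥 →L[ℂ] 𝔥) ζ) :=
  Classical.choose_spec α.exists_rho b ξ hξ ζ

/-- Compatibility `α ⊥ β` of two factorizations of the same Hilbert space:
`[ρ_α(𝔅†) β] = β` and `[ρ_β(ℭ†) α] = α`. -/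
structure Compatible (α : CFact 𝔅 H) (β : CFact ℭ H) : Prop where
  left : cspan {η' : 𝔨 →L[ℂ] H | ∃ b, ∃ η ∈ β.space, α.rho b ∘L η = η'} = β.space
  right : cspan {ξ' : 𝔥 →L[ℂ] H | ∃ c, ∃ ξ ∈ α.space, β.rho c ∘L ξ = ξ'} = α.space

end CFact

section RelTensor

variable {𝔥 : Type u} [NormedAddCommGroup 𝔥] [InnerProductSpace ℂ 𝔥] [CompleteSpace 𝔥]
  {𝔨 : Type u} [NormedAddCommGroup 𝔨] [InnerProductSpace ℂ 𝔨] [CompleteSpace 𝔨]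
  {𝔅 : CStarBase 𝔥} {ℭ : CStarBase 𝔨}
  {H : Type u} [NormedAddCommGroup H] [InnerProductSpace ℂ H] [CompleteSpace H]
  {K : Type u} [NormedAddCommGroup K] [InnerProductSpace ℂ K] [CompleteSpace K]

/-- The algebraic tensor product `α ⊙ 𝔥 ⊙ δ`. -/
def PreRelTensor (α : CFact 𝔅 H) (δ : CFact 𝔅.op K) : Type u :=
  α.space ⊗[ℂ] (𝔥 ⊗[ℂ] δ.space)

namespace PreRelTensor

variable (α : CFact 𝔅 H) (δ : CFact 𝔅.op K)

instance : AddCommGroup (PreRelTensor α δ) :=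
  inferInstanceAs (AddCommGroup (α.space ⊗[ℂ] (𝔥 ⊗[ℂ] δ.space)))

instance : Module ℂ (PreRelTensor α δ) :=
  inferInstanceAs (Module ℂ (α.space ⊗[ℂ] (𝔥 ⊗[ℂ] δ.space)))

variable {α δ}

/-- The elementary tensor `ξ ⊙ ζ ⊙ η`. -/
def tmul (ξ : α.space) (ζ : 𝔥) (η : δ.space) : PreRelTensor α δ :=
  ξ ⊗ₜ[ℂ] (ζ ⊗ₜ[ℂ] η)

/-- The evaluation `ζ ⊙ η ↦ η ζ`. -/
def evalRight (δ : CFact 𝔅.op K) : 𝔥 ⊗[ℂ] δ.space →ₗ[ℂ] K :=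
  TensorProduct.lift (LinearMap.mk₂ ℂ (fun ζ (η : δ.space) => (η : 𝔥 →L[ℂ] K) ζ)
    (by simp) (by simp) (by simp) (by simp))

/-- The evaluation `ξ ⊙ ζ ↦ ξ ζ`. -/
def evalLeft (α : CFact 𝔅 H) : α.space ⊗[ℂ] 𝔥 →ₗ[ℂ] H :=
  TensorProduct.lift (LinearMap.mk₂ ℂ (fun (ξ : α.space) ζ => (ξ : 𝔥 →L[ℂ] H) ζ)
    (by simp) (by simp) (by simp) (by simp))

/-- The linear map `ξ' ⊙ ζ' ⊙ η' ↦ ξ* ξ' η* η' ζ'`. -/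
def slice (ξ : α.space) (η : δ.space) : PreRelTensor α δ →ₗ[ℂ] 𝔥 :=
  ((ξ : 𝔥 →L[ℂ] H).adjoint : H →ₗ[ℂ] 𝔥) ∘ₗ evalLeft α ∘ₗ
    TensorProduct.map LinearMap.id
      (((η : 𝔥 →L[ℂ] K).adjoint : K →ₗ[ℂ] 𝔥) ∘ₗ evalRight δ)

lemma slice_tmul (ξ ξ' : α.space) (η η' : δ.space) (ζ' : 𝔥) :
    slice ξ η (tmul ξ' ζ' η') =
      ((ξ : 𝔥 →L[ℂ] H).adjoint ∘L (ξ' : 𝔥 →L[ℂ] H)) (((η : 𝔥 →L[ℂ] K).adjoint ∘L (η' : 𝔥 →L[ℂ] K)) ζ') := by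
  rfl

@[elab_as_elim]
lemma induction {p : PreRelTensor α δ → Prop} (h0 : p 0)
    (h1 : ∀ ξ ζ η, p (tmul ξ ζ η)) (h2 : ∀ x y, p x → p y → p (x + y)) (x) : p x := by
  refine TensorProduct.induction_on (motive := p) x h0 (fun ξ y => ?_) h2
  refine TensorProduct.induction_on (motive := fun y => p (ξ ⊗ₜ[ℂ] y)) y ?_ (h1 ξ) ?_
  · rw [TensorProduct.tmul_zero]; exact h0
  · intro a b ha hb
    rw [TensorProduct.tmul_add]; exact h2 _ _ ha hb

lemma hom_ext {M : Type*} [AddCommGroup M] [Module ℂ M] {f g : PreRelTensor α δ →ₗ[ℂ] M}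
    (h : ∀ ξ ζ η, f (tmul ξ ζ η) = g (tmul ξ ζ η)) : f = g :=
  LinearMap.ext fun x => induction (by simp) h (fun _ _ h1 h2 => by simp [h1, h2]) x

lemma slice_add_left (ξ₁ ξ₂ : α.space) (η : δ.space) :
    slice (ξ₁ + ξ₂) η = slice ξ₁ η + slice ξ₂ η :=
  hom_ext fun _ _ _ => by simp [slice_tmul]

lemma slice_add_right (ξ : α.space) (η₁ η₂ : δ.space) :
    slice ξ (η₁ + η₂) = slice ξ η₁ + slice ξ η₂ :=
  hom_ext fun _ _ _ => by simp [slice_tmul]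

lemma slice_smul_left (c : ℂ) (ξ : α.space) (η : δ.space) :
    slice (c • ξ) η = starRingEnd ℂ c • slice ξ η :=
  hom_ext fun _ _ _ => by simp [slice_tmul, LinearIsometryEquiv.map_smulₛₗ]

lemma slice_smul_right (c : ℂ) (ξ : α.space) (η : δ.space) :
    slice ξ (c • η) = starRingEnd ℂ c • slice ξ η :=
  hom_ext fun _ _ _ => by simp [slice_tmul, LinearIsometryEquiv.map_smulₛₗ]

/-- The sesquilinear form
`⟨ξ ⊙ ζ ⊙ η | ξ' ⊙ ζ' ⊙ η'⟩ = ⟨ζ | (ξ* ξ') (η* η') ζ'⟩` on `α ⊙ 𝔥 ⊙ δ`. -/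
def form (α : CFact 𝔅 H) (δ : CFact 𝔅.op K) :
    PreRelTensor α δ →ₗ⋆[ℂ] PreRelTensor α δ →ₗ[ℂ] ℂ :=
  TensorProduct.lift (LinearMap.mk₂'ₛₗ (starRingEnd ℂ) (starRingEnd ℂ)
    (fun ξ y => TensorProduct.lift (LinearMap.mk₂'ₛₗ (starRingEnd ℂ) (starRingEnd ℂ)
      (fun ζ η => (innerₛₗ ℂ ζ) ∘ₗ slice ξ η)
      (fun _ _ _ => by ext; simp)
      (fun _ _ _ => by ext; simp)
      (fun _ _ _ => by ext; simp [slice_add_right, inner_add_right])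
      (fun _ _ _ => by ext; simp [slice_smul_right, inner_smul_right])) y)
    (fun ξ₁ ξ₂ y => by
      refine TensorProduct.induction_on y (by simp) (fun ζ η => ?_) (fun a b ha hb => ?_)
      · ext; simp [slice_add_left, inner_add_right]
      · rw [map_add, ha, hb, map_add, map_add]; abel)
    (fun c ξ y => by
      refine TensorProduct.induction_on y (by simp) (fun ζ η => ?_) (fun a b ha hb => ?_)
      · ext; simp [slice_smul_left, inner_smul_right]
      · rw [map_add, ha, hb, map_add, smul_add])
    (fun _ _ _ => by rw [map_add])
    (fun _ _ _ => by rw [LinearMap.map_smulₛₗ]))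

lemma form_tmul (ξ ξ' : α.space) (ζ ζ' : 𝔥) (η η' : δ.space) :
    form α δ (tmul ξ ζ η) (tmul ξ' ζ' η') =
      ⟪ζ, ((ξ : 𝔥 →L[ℂ] H).adjoint ∘L (ξ' : 𝔥 →L[ℂ] H)) (((η : 𝔥 →L[ℂ] K).adjoint ∘L (η' : 𝔥 →L[ℂ] K)) ζ')⟫_ℂ := by
  rw [← slice_tmul]; rfl

lemma commute (ξ ξ' : α.space) (η η' : δ.space) :
    Commute ((ξ : 𝔥 →L[ℂ] H).adjoint ∘L (ξ' : 𝔥 →L[ℂ] H)) ((η : 𝔥 →L[ℂ] K).adjoint ∘L (η' : 𝔥 →L[ℂ] K)) :=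
  𝔅.commute _ (α.adjoint_mul_mem ξ.2 ξ'.2) _ (δ.adjoint_mul_mem η.2 η'.2)

lemma exists_sum (x : PreRelTensor α δ) : ∃ (n : ℕ) (ξ : Fin n → α.space) (ζ : Fin n → 𝔥)
    (η : Fin n → δ.space), x = ∑ i, tmul (ξ i) (ζ i) (η i) := by
  refine induction ⟨0, Fin.elim0, Fin.elim0, Fin.elim0, by simp⟩
    (fun ξ ζ η => ⟨1, fun _ => ξ, fun _ => ζ, fun _ => η, by simp⟩) ?_ x
  rintro _ _ ⟨n, ξ, ζ, η, rfl⟩ ⟨m, ξ', ζ', η', rfl⟩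
  exact ⟨n + m, Fin.append ξ ξ', Fin.append ζ ζ', Fin.append η η', by simp [Fin.sum_univ_add]⟩

/-- The form above is a (possibly degenerate) inner product. -/
abbrev core (α : CFact 𝔅 H) (δ : CFact 𝔅.op K) :
    PreInnerProductSpace.Core ℂ (PreRelTensor α δ) where
  inner x y := form α δ x y
  conj_inner_symm x y := by
    refine induction (by simp) (fun ξ ζ η => ?_) (fun a b ha hb => by simp [ha, hb]) x
    refine induction (by simp) (fun ξ' ζ' η' => ?_) (fun a b ha hb => by simp [ha, hb]) y
    have h : ∀ z, ((ξ : 𝔥 →L[ℂ] H).adjoint) ((ξ' : 𝔥 →L[ℂ] H)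
        ((η : 𝔥 →L[ℂ] K).adjoint ((η' : 𝔥 →L[ℂ] K) z))) =
        ((η : 𝔥 →L[ℂ] K).adjoint) ((η' : 𝔥 →L[ℂ] K)
        ((ξ : 𝔥 →L[ℂ] H).adjoint ((ξ' : 𝔥 →L[ℂ] H) z))) := fun z =>
      congrArg (fun A => A z) (commute ξ ξ' η η').eq
    rw [form_tmul, form_tmul, inner_conj_symm]
    simp only [ContinuousLinearMap.comp_apply, h, ContinuousLinearMap.adjoint_inner_right,
      ContinuousLinearMap.adjoint_inner_left]
    rw [← ContinuousLinearMap.adjoint_inner_right, ContinuousLinearMap.adjoint_inner_left]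
  re_inner_nonneg x := by
    obtain ⟨n, ξ, ζ, η, rfl⟩ := exists_sum x
    have := kernel_nonneg (fun i => (ξ i : 𝔥 →L[ℂ] H)) (fun i => (η i : 𝔥 →L[ℂ] K))
      (fun i j k l => commute _ _ _ _) ζ
    change 0 ≤ (form α δ _ _).re
    simp only [map_sum, LinearMap.sum_apply, form_tmul]
    refine le_of_le_of_eq this (congrArg Complex.re ?_)
    rw [Finset.sum_comm]
    simp only [ContinuousLinearMap.comp_apply, ContinuousLinearMap.adjoint_inner_right]
  add_left x y z := by simp
  smul_left x y c := by simp

instance : SeminormedAddCommGroup (PreRelTensor α δ) :=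
  @InnerProductSpace.Core.toSeminormedAddCommGroup ℂ _ _ _ _ (core α δ)

instance : InnerProductSpace ℂ (PreRelTensor α δ) := InnerProductSpace.ofCore (core α δ)

end PreRelTensor

/-- The `C*`-relative tensor product `H _α⊗_δ K = α ⊗ 𝔥 ⊗ δ`: the Hilbert space obtained from
the algebraic tensor product `α ⊙ 𝔥 ⊙ δ` with the inner product
`⟨ξ ⊙ ζ ⊙ η | ξ' ⊙ ζ' ⊙ η'⟩ = ⟨ζ | (ξ* ξ') (η* η') ζ'⟩` by factoring out the null space and
taking the completion. -/
def RelTensor (α : CFact 𝔅 H) (δ : CFact 𝔅.op K) : Type u :=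
  UniformSpace.Completion (PreRelTensor α δ)

namespace RelTensor

variable {α : CFact 𝔅 H} {δ : CFact 𝔅.op K}

instance : NormedAddCommGroup (RelTensor α δ) :=
  inferInstanceAs (NormedAddCommGroup (UniformSpace.Completion (PreRelTensor α δ)))

instance : InnerProductSpace ℂ (RelTensor α δ) :=
  inferInstanceAs (InnerProductSpace ℂ (UniformSpace.Completion (PreRelTensor α δ)))

instance : CompleteSpace (RelTensor α δ) :=
  inferInstanceAs (CompleteSpace (UniformSpace.Completion (PreRelTensor α δ)))

/-- The elementary tensor `ξ ⊗ ζ ⊗ η`. -/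
def tmul (ξ : α.space) (ζ : 𝔥) (η : δ.space) : RelTensor α δ :=
  ((PreRelTensor.tmul ξ ζ η : PreRelTensor α δ) : UniformSpace.Completion (PreRelTensor α δ))

lemma inner_tmul (ξ ξ' : α.space) (ζ ζ' : 𝔥) (η η' : δ.space) :
    ⟪tmul ξ ζ η, tmul ξ' ζ' η'⟫_ℂ =
      ⟪(ξ : 𝔥 →L[ℂ] H) ζ, (ξ' : 𝔥 →L[ℂ] H) (((η : 𝔥 →L[ℂ] K).adjoint ∘L (η' : 𝔥 →L[ℂ] K)) ζ')⟫_ℂ := by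
  refine (UniformSpace.Completion.inner_coe (𝕜 := ℂ) (PreRelTensor.tmul ξ ζ η)
    (PreRelTensor.tmul ξ' ζ' η')).trans ?_
  refine (PreRelTensor.form_tmul ξ ξ' ζ ζ' η η').trans ?_
  rw [ContinuousLinearMap.comp_apply, ContinuousLinearMap.adjoint_inner_right]

lemma total (α : CFact 𝔅 H) (δ : CFact 𝔅.op K) :
    cspan (Set.range fun i : α.space × 𝔥 × δ.space => tmul i.1 i.2.1 i.2.2) = ⊤ := by
  rw [eq_top_iff]
  intro x _
  refine UniformSpace.Completion.induction_on x (isClosed_cspan _) fun a => ?_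
  refine PreRelTensor.induction ?_ (fun ξ ζ η => subset_cspan ⟨(ξ, ζ, η), rfl⟩) ?_ a
  · exact zero_mem (cspan _)
  · intro a b ha hb
    rw [UniformSpace.Completion.coe_add]; exact Submodule.add_mem (cspan _) ha hb

end RelTensor

end RelTensor

namespace CRel

lemma ext_inner_total {V : Type*} [NormedAddCommGroup V] [InnerProductSpace ℂ V] {Y : Set V}
    (hY : cspan Y = ⊤) {x y : V} (h : ∀ v ∈ Y, ⟪v, x⟫_ℂ = ⟪v, y⟫_ℂ) : x = y := by
  have h1 : cspan Y ≤ (Submodule.span ℂ {x - y})ᗮ := by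
    refine cspan_le (Submodule.isClosed_orthogonal _) fun v hv => ?_
    rw [SetLike.mem_coe, Submodule.mem_orthogonal_singleton_iff_inner_left, inner_sub_right,
      h v hv, sub_self]
  rw [hY] at h1
  have h2 : x - y ∈ (Submodule.span ℂ {x - y})ᗮ := h1 trivial
  rw [Submodule.mem_orthogonal_singleton_iff_inner_left, inner_self_eq_zero] at h2
  exact sub_eq_zero.1 h2

lemma ext_total {V W : Type*} [NormedAddCommGroup V] [NormedSpace ℂ V] [NormedAddCommGroup W]
    [NormedSpace ℂ W] {Y : Set V} (hY : cspan Y = ⊤) {A B : V →L[ℂ] W}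
    (h : ∀ v ∈ Y, A v = B v) : A = B := by
  refine ContinuousLinearMap.ext_on (s := Y) ?_ h
  rw [dense_iff_closure_eq, ← Submodule.topologicalClosure_coe]
  exact congrArg SetLike.coe hY

lemma cspan_subtype {E F : Type*} [NormedAddCommGroup E] [NormedSpace ℂ E]
    [NormedAddCommGroup F] [NormedSpace ℂ F] {Y : Set E} {D : Submodule ℂ E} (hD : cspan Y = D)
    (G : D →L[ℂ] F) {N : Submodule ℂ F} (hN : IsClosed (N : Set F))
    (h : ∀ y, y ∈ Y → ∀ (hy' : y ∈ D), G ⟨y, hy'⟩ ∈ N) (d : D) : G d ∈ N := by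
  have hDc : IsClosed (D : Set E) := by rw [← hD]; exact isClosed_cspan Y
  have h1 : IsClosed (((N.comap G.toLinearMap).map D.subtype : Submodule ℂ E) : Set E) := by
    rw [Submodule.map_coe]
    exact hDc.isClosedEmbedding_subtypeVal.isClosedMap _ (hN.preimage G.continuous)
  have h2 : cspan Y ≤ (N.comap G.toLinearMap).map D.subtype := by
    refine cspan_le h1 fun y hy => ?_
    have hy' : y ∈ D := by rw [← hD]; exact subset_cspan hy
    exact ⟨⟨y, hy'⟩, h y hy hy', rfl⟩
  obtain ⟨d', hd', he⟩ := h2 (hD ▸ d.2 : (d : E) ∈ cspan Y)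
  have : d' = d := Subtype.ext he
  rw [← this]; exact hd'

end CRel

namespace RelTensor

variable {𝔥 : Type u} [NormedAddCommGroup 𝔥] [InnerProductSpace ℂ 𝔥] [CompleteSpace 𝔥]
  {𝔨 : Type u} [NormedAddCommGroup 𝔨] [InnerProductSpace ℂ 𝔨] [CompleteSpace 𝔨]
  {𝔩 : Type u} [NormedAddCommGroup 𝔩] [InnerProductSpace ℂ 𝔩] [CompleteSpace 𝔩]
  {𝔅 : CStarBase 𝔥} {ℭ : CStarBase 𝔨} {𝔇 : CStarBase 𝔩}
  {H : Type u} [NormedAddCommGroup H] [InnerProductSpace ℂ H] [CompleteSpace H]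
  {K : Type u} [NormedAddCommGroup K] [InnerProductSpace ℂ K] [CompleteSpace K]
  {α : CFact 𝔅 H} {δ : CFact 𝔅.op K}

lemma tmul_add_left (ξ ξ' : α.space) (ζ : 𝔥) (η : δ.space) :
    tmul (ξ + ξ') ζ η = tmul ξ ζ η + tmul ξ' ζ η := by
  unfold tmul
  refine Eq.trans ?_ (UniformSpace.Completion.coe_add _ _)
  exact congrArg _ (TensorProduct.add_tmul _ _ _)

lemma tmul_smul_left (c : ℂ) (ξ : α.space) (ζ : 𝔥) (η : δ.space) :
    tmul (c • ξ) ζ η = c • tmul ξ ζ η := by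
  unfold tmul
  refine Eq.trans ?_ (UniformSpace.Completion.coe_smul c (PreRelTensor.tmul ξ ζ η))
  exact congrArg _ (TensorProduct.smul_tmul' _ _ _).symm

lemma tmul_add_right (ξ : α.space) (ζ : 𝔥) (η η' : δ.space) :
    tmul ξ ζ (η + η') = tmul ξ ζ η + tmul ξ ζ η' := by
  unfold tmul
  refine Eq.trans ?_ (UniformSpace.Completion.coe_add _ _)
  refine congrArg _ ?_
  unfold PreRelTensor.tmul
  rw [TensorProduct.tmul_add, TensorProduct.tmul_add]
  rfl

lemma tmul_smul_right (c : ℂ) (ξ : α.space) (ζ : 𝔥) (η : δ.space) :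
    tmul ξ ζ (c • η) = c • tmul ξ ζ η := by
  unfold tmul
  refine Eq.trans ?_ (UniformSpace.Completion.coe_smul c (PreRelTensor.tmul ξ ζ η))
  refine congrArg _ ?_
  unfold PreRelTensor.tmul
  rw [TensorProduct.tmul_smul, TensorProduct.tmul_smul]
  rfl

lemma exists_ket1 (α : CFact 𝔅 H) (δ : CFact 𝔅.op K) :
    ∃ G : α.space →L[ℂ] K →L[ℂ] RelTensor α δ,
      ∀ (ξ : α.space) (η : δ.space) (ζ : 𝔥), G ξ ((η : 𝔥 →L[ℂ] K) ζ) = tmul ξ ζ η := by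
  obtain ⟨G, hG⟩ := exists_extend_family (M := α.space) (W := RelTensor α δ)
    (fun i : δ.space × 𝔥 => (i.1 : 𝔥 →L[ℂ] K) i.2) δ.total_range
    { toFun := fun ξ i => tmul ξ i.2 i.1
      map_add' := fun a b => by ext i; exact tmul_add_left _ _ _ _
      map_smul' := fun c b => by ext i; exact tmul_smul_left _ _ _ _ } (by
      intro ξ
      obtain ⟨R, hR⟩ := exists_defect (ξ : 𝔥 →L[ℂ] H)
      refine exists_extend _ _ δ.total_range ‖ξ‖ (norm_nonneg _) (fun _ => R)
        (fun i => (i.1 : 𝔥 →L[ℂ] K)) (fun i => i.2) ?_ ?_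
      · intro _ _ k l
        rw [hR]
        refine Commute.sub_left ?_ (PreRelTensor.commute _ _ _ _)
        exact (Commute.one_left _).smul_left _
      · intro i j
        rw [← ContinuousLinearMap.adjoint_inner_right R, ← ContinuousLinearMap.comp_apply, hR]
        simp only [LinearMap.coe_mk, AddHom.coe_mk, inner_tmul, sub_apply, smul_apply,
          ContinuousLinearMap.id_apply, inner_sub_right, inner_smul_right,
          ContinuousLinearMap.comp_apply, ContinuousLinearMap.adjoint_inner_right]
        rfl)
  exact ⟨G, fun ξ η ζ => hG ξ (η, ζ)⟩

/-- The operators `|ξ⟩₁ : K → H ⊗ K`, `η ζ ↦ ξ ⊗ ζ ⊗ η`, for `ξ ∈ α`. -/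
def ket1 (α : CFact 𝔅 H) (δ : CFact 𝔅.op K) : α.space →L[ℂ] K →L[ℂ] RelTensor α δ :=
  Classical.choose (exists_ket1 α δ)

lemma ket1_apply (ξ : α.space) (η : δ.space) (ζ : 𝔥) :
    ket1 α δ ξ ((η : 𝔥 →L[ℂ] K) ζ) = tmul ξ ζ η :=
  Classical.choose_spec (exists_ket1 α δ) ξ η ζ

lemma ket1_apply' (ξ : α.space) {η : 𝔥 →L[ℂ] K} (hη : η ∈ δ.space) (ζ : 𝔥) :
    ket1 α δ ξ (η ζ) = tmul ξ ζ ⟨η, hη⟩ := ket1_apply ξ ⟨η, hη⟩ ζ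

lemma exists_ket2 (α : CFact 𝔅 H) (δ : CFact 𝔅.op K) :
    ∃ G : δ.space →L[ℂ] H →L[ℂ] RelTensor α δ,
      ∀ (η : δ.space) (ξ : α.space) (ζ : 𝔥), G η ((ξ : 𝔥 →L[ℂ] H) ζ) = tmul ξ ζ η := by
  obtain ⟨G, hG⟩ := exists_extend_family (M := δ.space) (W := RelTensor α δ)
    (fun i : α.space × 𝔥 => (i.1 : 𝔥 →L[ℂ] H) i.2) α.total_range
    { toFun := fun η i => tmul i.1 i.2 η
      map_add' := fun a b => by ext i; exact tmul_add_right _ _ _ _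
      map_smul' := fun c b => by ext i; exact tmul_smul_right _ _ _ _ } (by
      intro η
      obtain ⟨R, hR⟩ := exists_defect (η : 𝔥 →L[ℂ] K)
      refine exists_extend _ _ α.total_range ‖η‖ (norm_nonneg _)
        (fun i => (i.1 : 𝔥 →L[ℂ] H)) (fun _ => R) (fun i => i.2) ?_ ?_
      · intro i j _ _
        rw [hR]
        refine Commute.sub_right ?_ (PreRelTensor.commute _ _ _ _)
        exact (Commute.one_right _).smul_right _
      · intro i j
        rw [hR]
        simp only [LinearMap.coe_mk, AddHom.coe_mk, inner_tmul, sub_apply, smul_apply,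
          ContinuousLinearMap.id_apply, inner_sub_right, inner_smul_right, map_sub, map_smul]
        rfl)
  exact ⟨G, fun η ξ ζ => hG η (ξ, ζ)⟩

/-- The operators `|η⟩₂ : H → H ⊗ K`, `ξ ζ ↦ ξ ⊗ ζ ⊗ η`, for `η ∈ δ`. -/
def ket2 (α : CFact 𝔅 H) (δ : CFact 𝔅.op K) : δ.space →L[ℂ] H →L[ℂ] RelTensor α δ :=
  Classical.choose (exists_ket2 α δ)

lemma ket2_apply (η : δ.space) (ξ : α.space) (ζ : 𝔥) :
    ket2 α δ η ((ξ : 𝔥 →L[ℂ] H) ζ) = tmul ξ ζ η :=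
  Classical.choose_spec (exists_ket2 α δ) η ξ ζ

lemma ket2_apply' (η : δ.space) {ξ : 𝔥 →L[ℂ] H} (hξ : ξ ∈ α.space) (ζ : 𝔥) :
    ket2 α δ η (ξ ζ) = tmul ⟨ξ, hξ⟩ ζ η := ket2_apply η ⟨ξ, hξ⟩ ζ

lemma adjoint_ket1 (ξ ξ' : α.space) : (ket1 α δ ξ).adjoint ∘L ket1 α δ ξ' =
    δ.rho ⟨(ξ : 𝔥 →L[ℂ] H).adjoint ∘L (ξ' : 𝔥 →L[ℂ] H), α.adjoint_mul_mem ξ.2 ξ'.2⟩ := by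
  refine δ.ext_op fun η hη ζ => ext_inner_total δ.total_range ?_
  rintro _ ⟨⟨η', ζ'⟩, rfl⟩
  rw [δ.rho_apply _ hη, ContinuousLinearMap.comp_apply, ContinuousLinearMap.adjoint_inner_right,
    ket1_apply]
  refine (congrArg _ (ket1_apply ξ' ⟨η, hη⟩ ζ)).trans ?_
  rw [inner_tmul, ← ContinuousLinearMap.adjoint_inner_right (ξ : 𝔥 →L[ℂ] H),
    ← ContinuousLinearMap.adjoint_inner_right (η' : 𝔥 →L[ℂ] K)]
  exact congrArg (fun A : 𝔥 →L[ℂ] 𝔥 => ⟪ζ', A ζ⟫_ℂ)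
    (PreRelTensor.commute ξ ξ' η' ⟨η, hη⟩).eq

lemma adjoint_ket2 (η η' : δ.space) : (ket2 α δ η).adjoint ∘L ket2 α δ η' =
    α.rho ⟨(η : 𝔥 →L[ℂ] K).adjoint ∘L (η' : 𝔥 →L[ℂ] K), δ.adjoint_mul_mem η.2 η'.2⟩ := by
  refine α.ext_op fun ξ hξ ζ => ext_inner_total α.total_range ?_
  rintro _ ⟨⟨ξ', ζ'⟩, rfl⟩
  rw [α.rho_apply _ hξ, ContinuousLinearMap.comp_apply, ContinuousLinearMap.adjoint_inner_right,
    ket2_apply]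
  refine (congrArg _ (ket2_apply η' ⟨ξ, hξ⟩ ζ)).trans ?_
  rw [inner_tmul]

lemma total_ket1 (α : CFact 𝔅 H) (δ : CFact 𝔅.op K) :
    cspan {z | ∃ ξ, ∃ w, ket1 α δ ξ w = z} = ⊤ := by
  rw [eq_top_iff, ← total α δ]
  refine cspan_le (isClosed_cspan _) ?_
  rintro _ ⟨⟨ξ, ζ, η⟩, rfl⟩
  exact subset_cspan ⟨ξ, _, ket1_apply ξ η ζ⟩

lemma total_ket2 (α : CFact 𝔅 H) (δ : CFact 𝔅.op K) :
    cspan {z | ∃ η, ∃ w, ket2 α δ η w = z} = ⊤ := by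
  rw [eq_top_iff, ← total α δ]
  refine cspan_le (isClosed_cspan _) ?_
  rintro _ ⟨⟨ξ, ζ, η⟩, rfl⟩
  exact subset_cspan ⟨η, _, ket2_apply η ξ ζ⟩

end RelTensor

section Tri

variable {𝔥 : Type u} [NormedAddCommGroup 𝔥] [InnerProductSpace ℂ 𝔥] [CompleteSpace 𝔥]
  {𝔨 : Type u} [NormedAddCommGroup 𝔨] [InnerProductSpace ℂ 𝔨] [CompleteSpace 𝔨]
  {𝔩 : Type u} [NormedAddCommGroup 𝔩] [InnerProductSpace ℂ 𝔩] [CompleteSpace 𝔩]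
  {𝔅 : CStarBase 𝔥} {ℭ : CStarBase 𝔨} {𝔇 : CStarBase 𝔩}
  {H : Type u} [NormedAddCommGroup H] [InnerProductSpace ℂ H] [CompleteSpace H]
  {K : Type u} [NormedAddCommGroup K] [InnerProductSpace ℂ K] [CompleteSpace K]
  {V : Type u} [NormedAddCommGroup V] [InnerProductSpace ℂ V] [CompleteSpace V]

/-- The factorization `[k β]` of `V`, for a family `k` of operators `H → V` with `[k H] = V` and
`[k* k β] = β`. -/
def CFact.ofKets {M : Type*} (k : M → H →L[ℂ] V) (β : CFact ℭ H)
    (h1 : cspan {z | ∃ m, ∃ w, k m w = z} = ⊤)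
    (h2 : cspan {c : 𝔨 →L[ℂ] H | ∃ m m', ∃ b ∈ β.space, ((k m).adjoint ∘L k m') ∘L b = c} =
      β.space) : CFact ℭ V where
  space := cspan {T : 𝔨 →L[ℂ] V | ∃ m, ∃ b ∈ β.space, k m ∘L b = T}
  isClosed_space := isClosed_cspan _
  adjoint_mul := by
    apply le_antisymm
    · refine cspan_le ℭ.isClosed_alg ?_
      rintro _ ⟨ξ, hξ, ξ', hξ', rfl⟩
      have step : ∀ m, ∀ b ∈ β.space, ∀ T ∈ cspan {T : 𝔨 →L[ℂ] V | ∃ m, ∃ b ∈ β.space,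
          k m ∘L b = T}, (k m ∘L b).adjoint ∘L T ∈ ℭ.alg.toSubmodule := by
        intro m b hb T hT
        refine cspan_map (ContinuousLinearMap.compL ℂ 𝔨 V 𝔨 (k m ∘L b).adjoint)
          ℭ.isClosed_alg ?_ hT
        rintro _ ⟨m', b', hb', rfl⟩
        have hmem : ((k m).adjoint ∘L k m') ∘L b' ∈ β.space := by
          rw [← h2]; exact subset_cspan ⟨m, m', b', hb', rfl⟩
        have := β.adjoint_mul_mem hb hmem
        rw [ContinuousLinearMap.compL_apply, ContinuousLinearMap.adjoint_comp]
        exact this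
      have hst : ∀ T T' : 𝔨 →L[ℂ] V, T.adjoint ∘L T' ∈ ℭ.alg → T'.adjoint ∘L T ∈ ℭ.alg := by
        intro T T' h
        have := star_mem h
        rwa [ContinuousLinearMap.star_eq_adjoint, ContinuousLinearMap.adjoint_comp,
          ContinuousLinearMap.adjoint_adjoint] at this
      apply hst
      refine cspan_map (N := ℭ.alg.toSubmodule)
        (ContinuousLinearMap.compL ℂ 𝔨 V 𝔨 ξ'.adjoint) ℭ.isClosed_alg ?_ hξ
      rintro _ ⟨m, b, hb, rfl⟩
      exact hst _ _ (step m b hb ξ' hξ')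
    · rw [← β.adjoint_mul]
      refine cspan_le (isClosed_cspan _) ?_
      rintro _ ⟨b, hb, b', hb', rfl⟩
      have hb'' := hb'
      rw [← h2] at hb''
      refine cspan_map (ContinuousLinearMap.compL ℂ 𝔨 H 𝔨 b.adjoint) (isClosed_cspan _) ?_ hb''
      rintro _ ⟨m, m', c, hc, rfl⟩
      refine subset_cspan ⟨k m ∘L b, subset_cspan ⟨m, b, hb, rfl⟩, k m' ∘L c,
        subset_cspan ⟨m', c, hc, rfl⟩, ?_⟩
      rw [ContinuousLinearMap.compL_apply, ContinuousLinearMap.adjoint_comp]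
      rfl
  mul_alg := by
    apply le_antisymm
    · refine cspan_le (isClosed_cspan _) ?_
      rintro _ ⟨ξ, hξ, c, hc, rfl⟩
      refine cspan_map ((ContinuousLinearMap.compL ℂ 𝔨 𝔨 V).flip c) (isClosed_cspan _) ?_ hξ
      rintro _ ⟨m, b, hb, rfl⟩
      exact subset_cspan ⟨m, b ∘L c, β.mul_mem hb hc, rfl⟩
    · refine cspan_le (isClosed_cspan _) ?_
      rintro _ ⟨m, b, hb, rfl⟩
      rw [← β.mul_alg] at hb
      refine cspan_map (ContinuousLinearMap.compL ℂ 𝔨 H V (k m)) (isClosed_cspan _) ?_ hb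
      rintro _ ⟨b', hb', c, hc, rfl⟩
      exact subset_cspan ⟨k m ∘L b', subset_cspan ⟨m, b', hb', rfl⟩, c, hc, rfl⟩
  total := by
    rw [eq_top_iff, ← h1]
    refine cspan_le (isClosed_cspan _) ?_
    rintro _ ⟨m, w, rfl⟩
    have hw : w ∈ cspan {z : H | ∃ ξ ∈ β.space, ∃ ζ : 𝔨, ξ ζ = z} := by rw [β.total]; trivial
    refine cspan_map (k m) (isClosed_cspan _) ?_ hw
    rintro _ ⟨b, hb, ζ, rfl⟩
    exact subset_cspan ⟨k m ∘L b, subset_cspan ⟨m, b, hb, rfl⟩, ζ, rfl⟩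

namespace RelTensor

lemma leftTri_aux (δ : CFact 𝔅.op K) {α : CFact 𝔅 H} {β : CFact ℭ H} (h : α.Compatible β) :
    cspan {c : 𝔨 →L[ℂ] H | ∃ η η', ∃ b ∈ β.space,
      ((ket2 α δ η).adjoint ∘L ket2 α δ η') ∘L b = c} = β.space := by
  apply le_antisymm
  · refine cspan_le β.isClosed_space ?_
    rintro _ ⟨η, η', b, hb, rfl⟩
    rw [adjoint_ket2, SetLike.mem_coe, ← h.left]
    exact subset_cspan ⟨_, b, hb, rfl⟩
  · rw [← h.left]
    refine cspan_le (isClosed_cspan _) ?_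
    rintro _ ⟨c, b, hb, rfl⟩
    rw [h.left]
    refine cspan_subtype δ.adjoint_mul
      (((ContinuousLinearMap.compL ℂ 𝔨 H H).flip b) ∘L α.rho) (isClosed_cspan _) ?_ c
    rintro _ ⟨η, hη, η', hη', rfl⟩ hy
    refine subset_cspan ⟨⟨η, hη⟩, ⟨η', hη'⟩, b, hb, ?_⟩
    rw [adjoint_ket2]
    rfl

lemma rightTri_aux (α : CFact 𝔅 H) {δ : CFact 𝔅.op K} {γ : CFact ℭ K} (h : γ.Compatible δ) :
    cspan {c : 𝔨 →L[ℂ] K | ∃ ξ ξ', ∃ b ∈ γ.space,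
      ((ket1 α δ ξ).adjoint ∘L ket1 α δ ξ') ∘L b = c} = γ.space := by
  apply le_antisymm
  · refine cspan_le γ.isClosed_space ?_
    rintro _ ⟨η, η', b, hb, rfl⟩
    rw [adjoint_ket1, SetLike.mem_coe, ← h.right]
    exact subset_cspan ⟨_, b, hb, rfl⟩
  · rw [← h.right]
    refine cspan_le (isClosed_cspan _) ?_
    rintro _ ⟨c, b, hb, rfl⟩
    rw [h.right]
    refine cspan_subtype α.adjoint_mul
      (((ContinuousLinearMap.compL ℂ 𝔨 K K).flip b) ∘L δ.rho) (isClosed_cspan _) ?_ c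
    rintro _ ⟨η, hη, η', hη', rfl⟩ hy
    refine subset_cspan ⟨⟨η, hη⟩, ⟨η', hη'⟩, b, hb, ?_⟩
    rw [adjoint_ket1]
    rfl

/-- The factorization `β ◁ δ = [|δ⟩₂ β]` of `H _α⊗_δ K`. -/
def leftTri (δ : CFact 𝔅.op K) {α : CFact 𝔅 H} {β : CFact ℭ H} (h : α.Compatible β) :
    CFact ℭ (RelTensor α δ) :=
  CFact.ofKets (fun η => ket2 α δ η) β (total_ket2 α δ) (leftTri_aux δ h)

/-- The factorization `α ▷ γ = [|α⟩₁ γ]` of `H _α⊗_δ K`. -/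
def rightTri (α : CFact 𝔅 H) {δ : CFact 𝔅.op K} {γ : CFact ℭ K} (h : γ.Compatible δ) :
    CFact ℭ (RelTensor α δ) :=
  CFact.ofKets (fun ξ => ket1 α δ ξ) γ (total_ket1 α δ) (rightTri_aux α h)

lemma leftTri_space (δ : CFact 𝔅.op K) {α : CFact 𝔅 H} {β : CFact ℭ H} (h : α.Compatible β) :
    (leftTri δ h).space = cspan {T | ∃ η, ∃ b ∈ β.space, ket2 α δ η ∘L b = T} := rfl

lemma rightTri_space (α : CFact 𝔅 H) {δ : CFact 𝔅.op K} {γ : CFact ℭ K}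
    (h : γ.Compatible δ) :
    (rightTri α h).space = cspan {T | ∃ ξ, ∃ c ∈ γ.space, ket1 α δ ξ ∘L c = T} := rfl

lemma mem_leftTri {δ : CFact 𝔅.op K} {α : CFact 𝔅 H} {β : CFact ℭ H} (h : α.Compatible β)
    (η : δ.space) {b : 𝔨 →L[ℂ] H} (hb : b ∈ β.space) :
    ket2 α δ η ∘L b ∈ (leftTri δ h).space := subset_cspan ⟨η, b, hb, rfl⟩

lemma mem_rightTri {α : CFact 𝔅 H} {δ : CFact 𝔅.op K} {γ : CFact ℭ K} (h : γ.Compatible δ)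
    (ξ : α.space) {c : 𝔨 →L[ℂ] K} (hc : c ∈ γ.space) :
    ket1 α δ ξ ∘L c ∈ (rightTri α h).space := subset_cspan ⟨ξ, c, hc, rfl⟩

lemma rho_mem {α : CFact 𝔅 H} {β : CFact ℭ H} (h : α.Compatible β) (c : ℭ.dual.toSubmodule)
    {ξ : 𝔥 →L[ℂ] H} (hξ : ξ ∈ α.space) : β.rho c ∘L ξ ∈ α.space := by
  rw [← h.right]; exact subset_cspan ⟨c, ξ, hξ, rfl⟩

lemma rho_mem' {α : CFact 𝔅 H} {β : CFact ℭ H} (h : α.Compatible β) (c : 𝔅.dual.toSubmodule)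
    {η : 𝔨 →L[ℂ] H} (hη : η ∈ β.space) : α.rho c ∘L η ∈ β.space := by
  rw [← h.left]; exact subset_cspan ⟨c, η, hη, rfl⟩

lemma leftTri_rho_ket1 {δ : CFact 𝔅.op K} {α : CFact 𝔅 H} {β : CFact ℭ H} (h : α.Compatible β)
    (c : ℭ.dual.toSubmodule) (ξ : α.space) :
    (leftTri δ h).rho c ∘L ket1 α δ ξ = ket1 α δ ⟨β.rho c ∘L ξ, rho_mem h c ξ.2⟩ := by
  have h2 : ∀ η, (leftTri δ h).rho c ∘L ket2 α δ η = ket2 α δ η ∘L β.rho c := by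
    refine fun η => β.ext_op fun b hb ζ => ?_
    have := (leftTri δ h).rho_apply c (mem_leftTri h η hb) ζ
    simp only [ContinuousLinearMap.comp_apply] at this ⊢
    rw [this, β.rho_apply c hb]
  refine δ.ext_op fun η hη ζ => ?_
  have h3 := congrArg (fun A => A ((ξ : 𝔥 →L[ℂ] H) ζ)) (h2 ⟨η, hη⟩)
  simp only [ContinuousLinearMap.comp_apply] at h3 ⊢
  rw [ket2_apply, ← ContinuousLinearMap.comp_apply (β.rho c),
    ket2_apply' _ (rho_mem h c ξ.2)] at h3
  rw [ket1_apply' _ hη, ket1_apply' _ hη, h3]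

lemma rightTri_rho_ket2 {α : CFact 𝔅 H} {δ : CFact 𝔅.op K} {γ : CFact ℭ K}
    (h : γ.Compatible δ) (c : ℭ.dual.toSubmodule) (η : δ.space) :
    (rightTri α h).rho c ∘L ket2 α δ η = ket2 α δ ⟨γ.rho c ∘L η, rho_mem' h c η.2⟩ := by
  have h2 : ∀ ξ, (rightTri α h).rho c ∘L ket1 α δ ξ = ket1 α δ ξ ∘L γ.rho c := by
    refine fun ξ => γ.ext_op fun b hb ζ => ?_
    have := (rightTri α h).rho_apply c (mem_rightTri h ξ hb) ζ
    simp only [ContinuousLinearMap.comp_apply] at this ⊢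
    rw [this, γ.rho_apply c hb]
  refine α.ext_op fun ξ hξ ζ => ?_
  have h3 := congrArg (fun A => A ((η : 𝔥 →L[ℂ] K) ζ)) (h2 ⟨ξ, hξ⟩)
  simp only [ContinuousLinearMap.comp_apply] at h3 ⊢
  rw [ket1_apply, ← ContinuousLinearMap.comp_apply (γ.rho c),
    ket1_apply' _ (rho_mem' h c η.2)] at h3
  rw [ket2_apply' _ hξ, ket2_apply' _ hξ, h3]

lemma compatible_tri {α : CFact 𝔅 H} {δ : CFact 𝔅.op K} {β : CFact ℭ H} {γ : CFact 𝔇 K}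
    (h : α.Compatible β) (h' : γ.Compatible δ) :
    (rightTri α h').Compatible (leftTri δ h) where
  left := by
    apply le_antisymm
    · refine cspan_le (isClosed_cspan _) ?_
      rintro _ ⟨c, x, hx, rfl⟩
      refine cspan_map (N := (leftTri δ h).space) (ContinuousLinearMap.compL ℂ 𝔨 _ _
        ((rightTri α h').rho c)) (isClosed_cspan _) ?_ hx
      rintro _ ⟨η, b, hb, rfl⟩
      have := mem_leftTri (δ := δ) h ⟨γ.rho c ∘L η, rho_mem' h' c η.2⟩ hb
      rw [← rightTri_rho_ket2] at this
      exact this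
    · refine cspan_le (isClosed_cspan _) ?_
      rintro _ ⟨η, b, hb, rfl⟩
      refine cspan_subtype h'.left (((ContinuousLinearMap.compL ℂ 𝔨 H (RelTensor α δ)).flip b) ∘L ket2 α δ)
        (isClosed_cspan _) ?_ η
      rintro _ ⟨c, η', hη', rfl⟩ hy
      refine subset_cspan ⟨c, ket2 α δ ⟨η', hη'⟩ ∘L b, mem_leftTri h _ hb, ?_⟩
      exact congrArg (fun A => A ∘L b) (rightTri_rho_ket2 h' c ⟨η', hη'⟩)
  right := by
    apply le_antisymm
    · refine cspan_le (isClosed_cspan _) ?_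
      rintro _ ⟨c, x, hx, rfl⟩
      refine cspan_map (N := (rightTri α h').space) (ContinuousLinearMap.compL ℂ 𝔩 _ _
        ((leftTri δ h).rho c)) (isClosed_cspan _) ?_ hx
      rintro _ ⟨ξ, b, hb, rfl⟩
      have := mem_rightTri (α := α) h' ⟨β.rho c ∘L ξ, rho_mem h c ξ.2⟩ hb
      rw [← leftTri_rho_ket1] at this
      exact this
    · refine cspan_le (isClosed_cspan _) ?_
      rintro _ ⟨ξ, b, hb, rfl⟩
      refine cspan_subtype h.right (((ContinuousLinearMap.compL ℂ 𝔩 K (RelTensor α δ)).flip b) ∘L ket1 α δ)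
        (isClosed_cspan _) ?_ ξ
      rintro _ ⟨c, ξ', hξ', rfl⟩ hy
      refine subset_cspan ⟨c, ket1 α δ ⟨ξ', hξ'⟩ ∘L b, mem_rightTri h' _ hb, ?_⟩
      exact congrArg (fun A => A ∘L b) (leftTri_rho_ket1 h c ⟨ξ', hξ'⟩)

end RelTensor

end Tri

section Morphisms

variable {𝔥 : Type u} [NormedAddCommGroup 𝔥] [InnerProductSpace ℂ 𝔥] [CompleteSpace 𝔥]
  {𝔨 : Type u} [NormedAddCommGroup 𝔨] [InnerProductSpace ℂ 𝔨] [CompleteSpace 𝔨]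
  {𝔩 : Type u} [NormedAddCommGroup 𝔩] [InnerProductSpace ℂ 𝔩] [CompleteSpace 𝔩]
  {𝔅 : CStarBase 𝔥} {ℭ : CStarBase 𝔨} {𝔇 : CStarBase 𝔩}
  {H : Type u} [NormedAddCommGroup H] [InnerProductSpace ℂ H] [CompleteSpace H]
  {K : Type u} [NormedAddCommGroup K] [InnerProductSpace ℂ K] [CompleteSpace K]
  {L : Type u} [NormedAddCommGroup L] [InnerProductSpace ℂ L] [CompleteSpace L]
  {M : Type u} [NormedAddCommGroup M] [InnerProductSpace ℂ M] [CompleteSpace M]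

/-- `α.IsHom β T` says that `T ∈ L(H_α, L_β)`, i.e. `T α ⊆ β` and `T* β ⊆ α`. -/
structure CFact.IsHom (α : CFact 𝔅 H) (β : CFact 𝔅 L) (T : H →L[ℂ] L) : Prop where
  map_mem : ∀ ξ ∈ α.space, T ∘L ξ ∈ β.space
  adjoint_mem : ∀ η ∈ β.space, T.adjoint ∘L η ∈ α.space

lemma CFact.IsHom.id (α : CFact 𝔅 H) : α.IsHom α (ContinuousLinearMap.id ℂ H) where
  map_mem ξ hξ := by simpa using hξ
  adjoint_mem ξ hξ := by
    have h : (ContinuousLinearMap.id ℂ H).adjoint = ContinuousLinearMap.id ℂ H :=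
      ContinuousLinearMap.ext fun x => ext_inner_left ℂ fun y => by
        rw [ContinuousLinearMap.adjoint_inner_right]; rfl
    rw [h]; exact hξ

lemma CFact.IsHom.comp {α : CFact 𝔅 H} {β : CFact 𝔅 K} {γ : CFact 𝔅 L} {T : K →L[ℂ] L}
    {S : H →L[ℂ] K} (hT : β.IsHom γ T) (hS : α.IsHom β S) : α.IsHom γ (T ∘L S) where
  map_mem ξ hξ := by
    have h := hT.map_mem _ (hS.map_mem ξ hξ)
    rw [ContinuousLinearMap.comp_assoc]
    exact h
  adjoint_mem η hη := by
    have h := hS.adjoint_mem _ (hT.adjoint_mem η hη)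
    rw [ContinuousLinearMap.adjoint_comp, ContinuousLinearMap.comp_assoc]
    exact h

lemma CFact.IsHom.adjoint {α : CFact 𝔅 H} {β : CFact 𝔅 L} {T : H →L[ℂ] L}
    (hT : α.IsHom β T) : β.IsHom α T.adjoint where
  map_mem := hT.adjoint_mem
  adjoint_mem := by rw [ContinuousLinearMap.adjoint_adjoint]; exact hT.map_mem

namespace RelTensor

variable {α : CFact 𝔅 H} {δ : CFact 𝔅.op K} {β : CFact 𝔅 L} {γ : CFact 𝔅.op M}

lemma exists_map_left (δ : CFact 𝔅.op K) {S : H →L[ℂ] L} (hS : α.IsHom β S) :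
    ∃ R : RelTensor α δ →L[ℂ] RelTensor β δ, ∀ ξ ζ η, R (tmul ξ ζ η) =
      tmul ⟨S ∘L (ξ : 𝔥 →L[ℂ] H), hS.map_mem _ ξ.2⟩ ζ η := by
  obtain ⟨D, hD⟩ := exists_defect S
  obtain ⟨R, hR, -⟩ := exists_extend (fun i : α.space × 𝔥 × δ.space => tmul i.1 i.2.1 i.2.2)
    (fun i => (tmul ⟨S ∘L (i.1 : 𝔥 →L[ℂ] H), hS.map_mem _ i.1.2⟩ i.2.1 i.2.2 : RelTensor β δ))
    (total α δ) ‖S‖ (norm_nonneg _) (fun i => D ∘L (i.1 : 𝔥 →L[ℂ] H))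
    (fun i => (i.2.2 : 𝔥 →L[ℂ] K)) (fun i => i.2.1) (by
      intro i j k l
      have h1 : (D ∘L (i.1 : 𝔥 →L[ℂ] H)).adjoint ∘L (D ∘L (j.1 : 𝔥 →L[ℂ] H)) =
          ((‖S‖ : ℂ) ^ 2) • ((i.1 : 𝔥 →L[ℂ] H).adjoint ∘L (j.1 : 𝔥 →L[ℂ] H)) -
          (S ∘L (i.1 : 𝔥 →L[ℂ] H)).adjoint ∘L (S ∘L (j.1 : 𝔥 →L[ℂ] H)) := by
        have := congrArg (fun A => (i.1 : 𝔥 →L[ℂ] H).adjoint ∘L (A ∘L (j.1 : 𝔥 →L[ℂ] H))) hD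
        rw [ContinuousLinearMap.adjoint_comp, ContinuousLinearMap.adjoint_comp]
        refine this.trans ?_
        ext z
        simp
      rw [h1]
      refine Commute.sub_left ((PreRelTensor.commute _ _ _ _).smul_left _) ?_
      exact PreRelTensor.commute (α := β) ⟨_, hS.map_mem _ i.1.2⟩ ⟨_, hS.map_mem _ j.1.2⟩ _ _)
    (by
      intro i j
      rw [inner_tmul, inner_tmul, ContinuousLinearMap.comp_apply D,
        ContinuousLinearMap.comp_apply D, ← ContinuousLinearMap.adjoint_inner_right D,
        ← ContinuousLinearMap.comp_apply D.adjoint, hD]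
      simp [inner_sub_right, inner_smul_right, ContinuousLinearMap.adjoint_inner_right])
  exact ⟨R, fun ξ ζ η => hR (ξ, ζ, η)⟩

lemma exists_map_right (α : CFact 𝔅 H) {T : K →L[ℂ] M} (hT : δ.IsHom γ T) :
    ∃ R : RelTensor α δ →L[ℂ] RelTensor α γ, ∀ ξ ζ η, R (tmul ξ ζ η) =
      tmul ξ ζ ⟨T ∘L (η : 𝔥 →L[ℂ] K), hT.map_mem _ η.2⟩ := by
  obtain ⟨D, hD⟩ := exists_defect T
  have h1 : ∀ η η' : δ.space, (D ∘L (η : 𝔥 →L[ℂ] K)).adjoint ∘L (D ∘L (η' : 𝔥 →L[ℂ] K)) =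
      ((‖T‖ : ℂ) ^ 2) • ((η : 𝔥 →L[ℂ] K).adjoint ∘L (η' : 𝔥 →L[ℂ] K)) -
      (T ∘L (η : 𝔥 →L[ℂ] K)).adjoint ∘L (T ∘L (η' : 𝔥 →L[ℂ] K)) := by
    intro η η'
    have := congrArg (fun A => (η : 𝔥 →L[ℂ] K).adjoint ∘L (A ∘L (η' : 𝔥 →L[ℂ] K))) hD
    rw [ContinuousLinearMap.adjoint_comp, ContinuousLinearMap.adjoint_comp]
    refine this.trans ?_
    ext z
    simp
  obtain ⟨R, hR, -⟩ := exists_extend (fun i : α.space × 𝔥 × δ.space => tmul i.1 i.2.1 i.2.2)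
    (fun i => (tmul i.1 i.2.1 ⟨T ∘L (i.2.2 : 𝔥 →L[ℂ] K), hT.map_mem _ i.2.2.2⟩ : RelTensor α γ))
    (total α δ) ‖T‖ (norm_nonneg _) (fun i => (i.1 : 𝔥 →L[ℂ] H))
    (fun i => D ∘L (i.2.2 : 𝔥 →L[ℂ] K)) (fun i => i.2.1) (by
      intro i j k l
      rw [h1]
      refine Commute.sub_right ((PreRelTensor.commute _ _ _ _).smul_right _) ?_
      exact PreRelTensor.commute (δ := γ) _ _ ⟨_, hT.map_mem _ k.2.2.2⟩
        ⟨_, hT.map_mem _ l.2.2.2⟩)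
    (by
      intro i j
      rw [inner_tmul, inner_tmul, h1]
      simp [inner_sub_right, inner_smul_right])
  exact ⟨R, fun ξ ζ η => hR (ξ, ζ, η)⟩

lemma exists_map {S : H →L[ℂ] L} {T : K →L[ℂ] M} (hS : α.IsHom β S) (hT : δ.IsHom γ T) :
    ∃ R : RelTensor α δ →L[ℂ] RelTensor β γ, ∀ ξ ζ η, R (tmul ξ ζ η) =
      tmul ⟨S ∘L (ξ : 𝔥 →L[ℂ] H), hS.map_mem _ ξ.2⟩ ζ
        ⟨T ∘L (η : 𝔥 →L[ℂ] K), hT.map_mem _ η.2⟩ := by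
  obtain ⟨R₁, h₁⟩ := exists_map_left δ hS
  obtain ⟨R₂, h₂⟩ := exists_map_right β hT
  exact ⟨R₂ ∘L R₁, fun ξ ζ η => by rw [ContinuousLinearMap.comp_apply, h₁, h₂]⟩

/-- The operator `S ⊗ T : H _α⊗_δ K → L _β⊗_γ M`, `ξ ⊗ ζ ⊗ η ↦ S ξ ⊗ ζ ⊗ T η`, for
`S ∈ L(H_α, L_β)` and `T ∈ L(K_δ, M_γ)`. -/
def map {S : H →L[ℂ] L} {T : K →L[ℂ] M} (hS : α.IsHom β S) (hT : δ.IsHom γ T) :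
    RelTensor α δ →L[ℂ] RelTensor β γ := Classical.choose (exists_map hS hT)

variable {S : H →L[ℂ] L} {T : K →L[ℂ] M} (hS : α.IsHom β S) (hT : δ.IsHom γ T)

lemma map_tmul (ξ : α.space) (ζ : 𝔥) (η : δ.space) : map hS hT (tmul ξ ζ η) =
    tmul ⟨S ∘L (ξ : 𝔥 →L[ℂ] H), hS.map_mem _ ξ.2⟩ ζ
      ⟨T ∘L (η : 𝔥 →L[ℂ] K), hT.map_mem _ η.2⟩ :=
  Classical.choose_spec (exists_map hS hT) ξ ζ η

lemma map_ket1 (ξ : α.space) : map hS hT ∘L ket1 α δ ξ =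
    ket1 β γ ⟨S ∘L (ξ : 𝔥 →L[ℂ] H), hS.map_mem _ ξ.2⟩ ∘L T := by
  refine δ.ext_op fun η hη ζ => ?_
  rw [ContinuousLinearMap.comp_apply, ContinuousLinearMap.comp_apply, ket1_apply' _ hη,
    map_tmul, ← ContinuousLinearMap.comp_apply T, ket1_apply' _ (hT.map_mem _ hη)]

lemma map_ket2 (η : δ.space) : map hS hT ∘L ket2 α δ η =
    ket2 β γ ⟨T ∘L (η : 𝔥 →L[ℂ] K), hT.map_mem _ η.2⟩ ∘L S := by
  refine α.ext_op fun ξ hξ ζ => ?_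
  rw [ContinuousLinearMap.comp_apply, ContinuousLinearMap.comp_apply, ket2_apply' _ hξ,
    map_tmul, ← ContinuousLinearMap.comp_apply S, ket2_apply' _ (hS.map_mem _ hξ)]

lemma adjoint_map : (map hS hT).adjoint = map hS.adjoint hT.adjoint := by
  refine ext_total (total β γ) ?_
  rintro _ ⟨⟨ξ, ζ, η⟩, rfl⟩
  refine ext_inner_total (total α δ) ?_
  rintro _ ⟨⟨ξ', ζ', η'⟩, rfl⟩
  rw [ContinuousLinearMap.adjoint_inner_right, map_tmul, map_tmul, inner_tmul, inner_tmul]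
  simp [ContinuousLinearMap.adjoint_inner_right, ContinuousLinearMap.adjoint_comp]

lemma isHom_leftTri {β₁ : CFact ℭ H} {β₂ : CFact ℭ L} (h₁ : α.Compatible β₁)
    (h₂ : β.Compatible β₂) (hS' : β₁.IsHom β₂ S) :
    (leftTri δ h₁).IsHom (leftTri γ h₂) (map hS hT) := by
  have key : ∀ {H : Type u} [NormedAddCommGroup H] [InnerProductSpace ℂ H] [CompleteSpace H]
      {K : Type u} [NormedAddCommGroup K] [InnerProductSpace ℂ K] [CompleteSpace K]
      {L : Type u} [NormedAddCommGroup L] [InnerProductSpace ℂ L] [CompleteSpace L]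
      {M : Type u} [NormedAddCommGroup M] [InnerProductSpace ℂ M] [CompleteSpace M]
      {α : CFact 𝔅 H} {δ : CFact 𝔅.op K} {β : CFact 𝔅 L} {γ : CFact 𝔅.op M}
      {S : H →L[ℂ] L} {T : K →L[ℂ] M} (hS : α.IsHom β S) (hT : δ.IsHom γ T)
      {β₁ : CFact ℭ H} {β₂ : CFact ℭ L} (h₁ : α.Compatible β₁) (h₂ : β.Compatible β₂)
      (hS' : β₁.IsHom β₂ S), ∀ x ∈ (leftTri δ h₁).space,
      map hS hT ∘L x ∈ (leftTri γ h₂).space := by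
    intro H _ _ _ K _ _ _ L _ _ _ M _ _ _ α δ β γ S T hS hT β₁ β₂ h₁ h₂ hS' x hx
    refine cspan_map (ContinuousLinearMap.compL ℂ 𝔨 _ _ (map hS hT)) (isClosed_cspan _) ?_ hx
    rintro _ ⟨η, b, hb, rfl⟩
    have h := mem_leftTri h₂ ⟨T ∘L (η : 𝔥 →L[ℂ] K), hT.map_mem _ η.2⟩ (hS'.map_mem b hb)
    have h3 : map hS hT ∘L (ket2 α δ η ∘L b) = ket2 β γ _ ∘L (S ∘L b) :=
      congrArg (fun A => A ∘L b) (map_ket2 hS hT η)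
    change map hS hT ∘L (ket2 α δ η ∘L b) ∈ (leftTri γ h₂).space
    rw [h3]
    exact h
  refine ⟨key hS hT h₁ h₂ hS', ?_⟩
  rw [adjoint_map]
  exact key hS.adjoint hT.adjoint h₂ h₁ hS'.adjoint

lemma isHom_rightTri {γ₁ : CFact ℭ K} {γ₂ : CFact ℭ M} (h₁ : γ₁.Compatible δ)
    (h₂ : γ₂.Compatible γ) (hT' : γ₁.IsHom γ₂ T) :
    (rightTri α h₁).IsHom (rightTri β h₂) (map hS hT) := by
  have key : ∀ {H : Type u} [NormedAddCommGroup H] [InnerProductSpace ℂ H] [CompleteSpace H]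
      {K : Type u} [NormedAddCommGroup K] [InnerProductSpace ℂ K] [CompleteSpace K]
      {L : Type u} [NormedAddCommGroup L] [InnerProductSpace ℂ L] [CompleteSpace L]
      {M : Type u} [NormedAddCommGroup M] [InnerProductSpace ℂ M] [CompleteSpace M]
      {α : CFact 𝔅 H} {δ : CFact 𝔅.op K} {β : CFact 𝔅 L} {γ : CFact 𝔅.op M}
      {S : H →L[ℂ] L} {T : K →L[ℂ] M} (hS : α.IsHom β S) (hT : δ.IsHom γ T)
      {γ₁ : CFact ℭ K} {γ₂ : CFact ℭ M} (h₁ : γ₁.Compatible δ) (h₂ : γ₂.Compatible γ)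
      (hT' : γ₁.IsHom γ₂ T), ∀ x ∈ (rightTri α h₁).space,
      map hS hT ∘L x ∈ (rightTri β h₂).space := by
    intro H _ _ _ K _ _ _ L _ _ _ M _ _ _ α δ β γ S T hS hT γ₁ γ₂ h₁ h₂ hT' x hx
    refine cspan_map (ContinuousLinearMap.compL ℂ 𝔨 _ _ (map hS hT)) (isClosed_cspan _) ?_ hx
    rintro _ ⟨ξ, c, hc, rfl⟩
    have h := mem_rightTri h₂ ⟨S ∘L (ξ : 𝔥 →L[ℂ] H), hS.map_mem _ ξ.2⟩ (hT'.map_mem c hc)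
    have h3 : map hS hT ∘L (ket1 α δ ξ ∘L c) = ket1 β γ _ ∘L (T ∘L c) :=
      congrArg (fun A => A ∘L c) (map_ket1 hS hT ξ)
    change map hS hT ∘L (ket1 α δ ξ ∘L c) ∈ (rightTri β h₂).space
    rw [h3]
    exact h
  refine ⟨key hS hT h₁ h₂ hT', ?_⟩
  rw [adjoint_map]
  exact key hS.adjoint hT.adjoint h₂ h₁ hT'.adjoint

end RelTensor

end Morphisms

section Unit

variable {𝔥 : Type u} [NormedAddCommGroup 𝔥] [InnerProductSpace ℂ 𝔥] [CompleteSpace 𝔥]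

lemma CRel.mem_span_star_mul {A : Type*} [NonUnitalCStarAlgebra A] (x : A) :
    x ∈ Submodule.span ℂ {c : A | ∃ b : A, star b * b = c} := by
  let _ : PartialOrder A := CStarAlgebra.spectralOrder A
  have : StarOrderedRing A := CStarAlgebra.spectralOrderedRing A
  have h : x ∈ Submodule.span ℂ {a : A | 0 ≤ a} := by
    rw [CStarAlgebra.span_nonneg]; trivial
  refine Submodule.span_mono ?_ h
  rintro a (ha : 0 ≤ a)
  obtain ⟨b, hb⟩ := CStarAlgebra.nonneg_iff_eq_star_mul_self.1 ha
  exact ⟨b, hb.symm⟩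

/-- A concrete `C*`-algebra is the (closed) linear span of the elements `a* b`. -/
lemma CRel.cspan_star_mul (B : NonUnitalStarSubalgebra ℂ (𝔥 →L[ℂ] 𝔥))
    (hB : IsClosed (B : Set (𝔥 →L[ℂ] 𝔥))) :
    cspan {c : 𝔥 →L[ℂ] 𝔥 | ∃ a ∈ B.toSubmodule, ∃ b ∈ B.toSubmodule, a.adjoint ∘L b = c} =
      B.toSubmodule := by
  apply le_antisymm
  · refine cspan_le hB ?_
    rintro _ ⟨a, ha, b, hb, rfl⟩
    have h : star a * b ∈ B := B.mul_mem (star_mem (s := B) ha) hb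
    exact h
  · intro x hx
    have : IsClosed (B : Set (𝔥 →L[ℂ] 𝔥)) := hB
    have h := CRel.mem_span_star_mul (A := B) ⟨x, hx⟩
    have h2 : Submodule.span ℂ {c : B | ∃ b : B, star b * b = c} ≤
        (cspan {c : 𝔥 →L[ℂ] 𝔥 | ∃ a ∈ B.toSubmodule,
        ∃ b ∈ B.toSubmodule, a.adjoint ∘L b = c}).comap B.toSubmodule.subtype := by
      refine Submodule.span_le.2 fun a ha => ?_
      obtain ⟨b, rfl⟩ := ha
      exact subset_cspan ⟨b, b.2, b, b.2, rfl⟩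
    exact h2 h

/-- The algebra `𝔅` as a factorization of `𝔥` with respect to `(𝔥, 𝔅, 𝔅†)`. -/
def CFact.self (𝔅 : CStarBase 𝔥) : CFact 𝔅 𝔥 where
  space := 𝔅.alg.toSubmodule
  isClosed_space := 𝔅.isClosed_alg
  adjoint_mul := cspan_star_mul 𝔅.alg 𝔅.isClosed_alg
  mul_alg := by
    have := cspan_star_mul 𝔅.alg 𝔅.isClosed_alg
    refine Eq.trans (congrArg _ ?_) this
    ext c
    constructor
    · rintro ⟨a, ha, b, hb, rfl⟩
      refine ⟨star a, star_mem (s := 𝔅.alg) ha, b, hb, ?_⟩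
      rw [ContinuousLinearMap.star_eq_adjoint, ContinuousLinearMap.adjoint_adjoint]
    · rintro ⟨a, ha, b, hb, rfl⟩
      exact ⟨star a, star_mem (s := 𝔅.alg) ha, b, hb, rfl⟩
  total := 𝔅.alg_nondegenerate

lemma CFact.self_rho (𝔅 : CStarBase 𝔥) (c : 𝔅.dual.toSubmodule) :
    (CFact.self 𝔅).rho c = c := by
  refine (CFact.self 𝔅).ext_op fun b hb ζ => ?_
  rw [(CFact.self 𝔅).rho_apply c hb]
  exact congrArg (fun A => A ζ) (𝔅.commute b hb c c.2).eq

lemma CFact.compatible_self (𝔅 : CStarBase 𝔥) :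
    (CFact.self 𝔅).Compatible (CFact.self 𝔅.op) where
  left := by
    refine Eq.trans (congrArg _ ?_) (CFact.self 𝔅.op).mul_alg
    ext c
    constructor
    · rintro ⟨b, a, ha, rfl⟩
      rw [CFact.self_rho]
      exact ⟨b, b.2, a, ha, rfl⟩
    · rintro ⟨b, hb, a, ha, rfl⟩
      exact ⟨⟨b, hb⟩, a, ha, by rw [CFact.self_rho]⟩
  right := by
    refine Eq.trans (congrArg _ ?_) (CFact.self 𝔅).mul_alg
    ext c
    constructor
    · rintro ⟨b, a, ha, rfl⟩
      rw [CFact.self_rho]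
      exact ⟨b, b.2, a, ha, rfl⟩
    · rintro ⟨b, hb, a, ha, rfl⟩
      exact ⟨⟨b, hb⟩, a, ha, by rw [CFact.self_rho]⟩

end Unit

/-- A `C*`-`(𝔥, 𝔅, 𝔅†)`-`(𝔨, ℭ, ℭ†)`-bimodule `_βH_α`: a Hilbert space `H` with compatible
factorizations `α` (the field `right`) with respect to `(𝔨, ℭ, ℭ†)` and `β` (the field `left`) with
respect to `(𝔥, 𝔅†, 𝔅)`. -/
structure CBimod {𝔥 : Type u} [NormedAddCommGroup 𝔥] [InnerProductSpace ℂ 𝔥] [CompleteSpace 𝔥]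
    {𝔨 : Type u} [NormedAddCommGroup 𝔨] [InnerProductSpace ℂ 𝔨] [CompleteSpace 𝔨]
    (𝔅 : CStarBase 𝔥) (ℭ : CStarBase 𝔨) where
  carrier : Type u
  [normedAddCommGroup : NormedAddCommGroup carrier]
  [innerProductSpace : InnerProductSpace ℂ carrier]
  [completeSpace : CompleteSpace carrier]
  left : CFact 𝔅.op carrier
  right : CFact ℭ carrier
  compatible : right.Compatible left

namespace CBimod

open CategoryTheory

attribute [instance] normedAddCommGroup innerProductSpace completeSpace

variable {𝔥 : Type u} [NormedAddCommGroup 𝔥] [InnerProductSpace ℂ 𝔥] [CompleteSpace 𝔥]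
  {𝔨 : Type u} [NormedAddCommGroup 𝔨] [InnerProductSpace ℂ 𝔨] [CompleteSpace 𝔨]
  {𝔩 : Type u} [NormedAddCommGroup 𝔩] [InnerProductSpace ℂ 𝔩] [CompleteSpace 𝔩]
  {𝔅 : CStarBase 𝔥} {ℭ : CStarBase 𝔨} {𝔇 : CStarBase 𝔩}

/-- The morphisms `L(_βH_α, _δK_γ) = L(H_α, K_γ) ∩ L(H_β, K_δ)`. -/
@[ext]
structure Hom (X Y : CBimod 𝔅 ℭ) where
  toOp : X.carrier →L[ℂ] Y.carrier
  isHom_right : X.right.IsHom Y.right toOp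
  isHom_left : X.left.IsHom Y.left toOp

instance : Category (CBimod 𝔅 ℭ) where
  Hom := Hom
  id X := ⟨ContinuousLinearMap.id ℂ X.carrier, .id _, .id _⟩
  comp f g := ⟨g.toOp ∘L f.toOp, g.isHom_right.comp f.isHom_right,
    g.isHom_left.comp f.isHom_left⟩

/-- The `C*`-relative tensor product of bimodules: `H _α⊗_δ K` with the factorizations `β ◁ δ` and
`α ▷ γ`. -/
def tensorObj (X : CBimod 𝔅 ℭ) (Y : CBimod ℭ 𝔇) : CBimod 𝔅 𝔇 where
  carrier := RelTensor X.right Y.left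
  left := RelTensor.leftTri Y.left X.compatible
  right := RelTensor.rightTri X.right Y.compatible
  compatible := RelTensor.compatible_tri X.compatible Y.compatible

/-- The tensor product `S ⊗ T` of morphisms. -/
def tensorHom {X X' : CBimod 𝔅 ℭ} {Y Y' : CBimod ℭ 𝔇} (S : X ⟶ X') (T : Y ⟶ Y') :
    tensorObj X Y ⟶ tensorObj X' Y' where
  toOp := RelTensor.map S.isHom_right T.isHom_left
  isHom_right := RelTensor.isHom_rightTri S.isHom_right T.isHom_left Y.compatible Y'.compatible
    T.isHom_right
  isHom_left := RelTensor.isHom_leftTri S.isHom_right T.isHom_left X.compatible X'.compatible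
    S.isHom_left

/-- The bimodule `_{𝔅†}𝔥_𝔅`. -/
def unit (𝔅 : CStarBase 𝔥) : CBimod 𝔅 𝔅 where
  carrier := 𝔥
  left := CFact.self 𝔅.op
  right := CFact.self 𝔅
  compatible := CFact.compatible_self 𝔅

/-- The structure maps of a monoidal category on `(𝔥, 𝔅, 𝔅†)`-`(𝔥, 𝔅, 𝔅†)`-bimodules, with
`X ⊙ Y = tensorObj X Y`, `S ⊙ T = tensorHom S T`, unit `_{𝔅†}𝔥_𝔅` and given associators and
unitors. -/
@[reducible]
def monoidalStruct
    (a : ∀ X Y Z : CBimod 𝔅 𝔅, tensorObj (tensorObj X Y) Z ≅ tensorObj X (tensorObj Y Z))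
    (l : ∀ X : CBimod 𝔅 𝔅, tensorObj (unit 𝔅) X ≅ X)
    (r : ∀ X : CBimod 𝔅 𝔅, tensorObj X (unit 𝔅) ≅ X) :
    MonoidalCategoryStruct (CBimod 𝔅 𝔅) where
  tensorObj X Y := tensorObj X Y
  whiskerLeft X _ _ T := tensorHom (𝟙 X) T
  whiskerRight S Y := tensorHom S (𝟙 Y)
  tensorHom S T := tensorHom S T
  tensorUnit := unit 𝔅
  associator := a
  leftUnitor := l
  rightUnitor := r

/-- A morphism whose underlying operator is unitary. -/
def Hom.IsUnitary {X Y : CBimod 𝔅 ℭ} (S : X ⟶ Y) : Prop :=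
  S.toOp.adjoint ∘L S.toOp = ContinuousLinearMap.id ℂ X.carrier ∧
    S.toOp ∘L S.toOp.adjoint = ContinuousLinearMap.id ℂ Y.carrier

/-- The operator `|ξ⟩₁ : K → H ⊗ K` for `ξ` in the right factorization of `H`. -/
abbrev ket1 (X : CBimod 𝔅 ℭ) (Y : CBimod ℭ 𝔇) (ξ : X.right.space) :
    Y.carrier →L[ℂ] (tensorObj X Y).carrier := RelTensor.ket1 X.right Y.left ξ

/-- The operator `|η⟩₂ : H → H ⊗ K` for `η` in the left factorization of `K`. -/
abbrev ket2 (X : CBimod 𝔅 ℭ) (Y : CBimod ℭ 𝔇) (η : Y.left.space) :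
    X.carrier →L[ℂ] (tensorObj X Y).carrier := RelTensor.ket2 X.right Y.left η

/-- The elementary tensor `ξ ⊗ ζ ⊗ η`. -/
abbrev tmul (X : CBimod 𝔅 ℭ) (Y : CBimod ℭ 𝔇) (ξ : X.right.space) (ζ : 𝔨) (η : Y.left.space) :
    (tensorObj X Y).carrier := RelTensor.tmul ξ ζ η

end CBimod

end

/-!
The structure maps come from one principle: two total families of vectors with the same Gram matrix
are intertwined by a unitary (`CRel.exists_unitary`).

For the associator the families are `|θ⟩₂ |ξ⟩₁ k` and `|ξ⟩₁ |θ⟩₂ k`. Since `|ξ⟩₁* |ξ'⟩₁` is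
`ρ_δ(ξ* ξ')` and `|θ⟩₂* |θ'⟩₂` is `ρ_γ(θ* θ')`, and since the representations on an iterated tensor
product act on the inner factor alone, both Gram matrices consist of the numbers
`⟪k, ρ_δ(ξ* ξ') ρ_γ(θ* θ') k'⟫`, up to the order of the two representations; these commute by
compatibility of `γ` and `δ` (`RelTensor.inner_ket2_ket1`). For the unitors the families are the
elementary tensors and the vectors `ξ b ζ`; their Gram matrices agree because `𝔅` and `𝔅†` commute,
and the second family is total because the algebras are nondegenerate.

An isometry is a morphism as soon as it carries generators of one factorization to generators of the
other (`CFact.IsHom.of_isometry`). For the associator this follows from `a |θ⟩₂ |η⟩₂ = ||θ⟩₂ η⟩₂`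
and `a ||ξ⟩₁ c⟩₁ = |ξ⟩₁ |c⟩₁`. For the left unitor `l |ξ⟩₂ = ξ` and `l |b⟩₁ = ρ_β(b)` reduce it to
`[β 𝔅†] = β` and `[ρ_β(𝔅) α] = α`, and symmetrically for the right unitor. Naturality, the pentagon
and the triangle are checked on total families of vectors, where these formulas determine every
map involved.
-/

noncomputable section

open CRel

/-! ### Unitaries from total families -/

namespace CRel

/-- Two total families with the same Gram matrix are intertwined by a unitary. -/
lemma exists_unitary {ι V W : Type*} [NormedAddCommGroup V] [InnerProductSpace ℂ V]
    [CompleteSpace V] [NormedAddCommGroup W] [InnerProductSpace ℂ W] [CompleteSpace W]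
    (v : ι → V) (w : ι → W) (hv : cspan (Set.range v) = ⊤) (hw : cspan (Set.range w) = ⊤)
    (h : ∀ i j, ⟪v i, v j⟫_ℂ = ⟪w i, w j⟫_ℂ) :
    ∃ U : V →L[ℂ] W, (∀ i, U (v i) = w i) ∧
      U.adjoint ∘L U = ContinuousLinearMap.id ℂ V ∧
      U ∘L U.adjoint = ContinuousLinearMap.id ℂ W := by
  -- the defect kernel that controls the extension vanishes, so the operators `x`, `y` are zero
  obtain ⟨U, hU, -⟩ := exists_extend (𝔥 := ℂ) (H := ℂ) (K := ℂ) v w hv 1 zero_le_one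
    (fun _ => 0) (fun _ => 0) (fun _ => 0) (fun _ _ _ _ => by simp) (fun i j => by simp [h])
  have h1 : U.adjoint ∘L U = ContinuousLinearMap.id ℂ V := by
    refine ext_total hv ?_
    rintro _ ⟨i, rfl⟩
    refine ext_inner_total hv ?_
    rintro _ ⟨j, rfl⟩
    rw [ContinuousLinearMap.comp_apply, ContinuousLinearMap.adjoint_inner_right, hU, hU, ← h]
    rfl
  refine ⟨U, hU, h1, ext_total hw ?_⟩
  rintro _ ⟨i, rfl⟩
  rw [← hU]
  exact congrArg (fun A => U (A (v i))) h1

lemma cspan_range_comp {M ι H V : Type*} [NormedAddCommGroup H] [NormedSpace ℂ H]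
    [NormedAddCommGroup V] [NormedSpace ℂ V] (k : M → H →L[ℂ] V)
    (hk : cspan {z | ∃ m, ∃ w, k m w = z} = ⊤) {g : ι → H} (hg : cspan (Set.range g) = ⊤) :
    cspan (Set.range fun i : M × ι => k i.1 (g i.2)) = ⊤ := by
  rw [eq_top_iff, ← hk]
  refine cspan_le (isClosed_cspan _) ?_
  rintro _ ⟨m, w, rfl⟩
  refine cspan_map (k m) (isClosed_cspan _) ?_ (hg ▸ Submodule.mem_top : w ∈ cspan (Set.range g))
  rintro _ ⟨i, rfl⟩
  exact subset_cspan ⟨(m, i), rfl⟩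

/-- `[k Y] = [k [Y]]` for a family `k` of operators. -/
lemma cspan_comp_cspan {M 𝔩 H V : Type*} [NormedAddCommGroup 𝔩] [NormedSpace ℂ 𝔩]
    [NormedAddCommGroup H] [NormedSpace ℂ H] [NormedAddCommGroup V] [NormedSpace ℂ V]
    (k : M → H →L[ℂ] V) (Y : Set (𝔩 →L[ℂ] H)) :
    cspan {T | ∃ m, ∃ y ∈ Y, k m ∘L y = T} = cspan {T | ∃ m, ∃ y ∈ cspan Y, k m ∘L y = T} := by
  apply le_antisymm
  · refine cspan_le (isClosed_cspan _) ?_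
    rintro _ ⟨m, y, hy, rfl⟩
    exact subset_cspan ⟨m, y, subset_cspan hy, rfl⟩
  · refine cspan_le (isClosed_cspan _) ?_
    rintro _ ⟨m, y, hy, rfl⟩
    refine cspan_map (ContinuousLinearMap.compL ℂ 𝔩 H V (k m)) (isClosed_cspan _) ?_ hy
    exact fun y hy => subset_cspan ⟨m, y, hy, rfl⟩

/-- `[k(Z) Y] = [k(D) Y]` for `D = [Z]` and a bounded linear family `k` of operators over `D`. -/
lemma cspan_cspan_comp {E 𝔩 H V : Type*} [NormedAddCommGroup E] [NormedSpace ℂ E]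
    [NormedAddCommGroup 𝔩] [NormedSpace ℂ 𝔩]
    [NormedAddCommGroup H] [NormedSpace ℂ H] [NormedAddCommGroup V] [NormedSpace ℂ V]
    {Z : Set E} {D : Submodule ℂ E} (hD : cspan Z = D) (k : D →L[ℂ] H →L[ℂ] V)
    (Y : Set (𝔩 →L[ℂ] H)) :
    cspan {T | ∃ d : D, (d : E) ∈ Z ∧ ∃ y ∈ Y, k d ∘L y = T} =
      cspan {T | ∃ d, ∃ y ∈ Y, k d ∘L y = T} := by
  apply le_antisymm
  · refine cspan_le (isClosed_cspan _) ?_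
    rintro _ ⟨d, -, y, hy, rfl⟩
    exact subset_cspan ⟨d, y, hy, rfl⟩
  · refine cspan_le (isClosed_cspan _) ?_
    rintro _ ⟨d, y, hy, rfl⟩
    refine cspan_subtype hD (((ContinuousLinearMap.compL ℂ 𝔩 H V).flip y) ∘L k)
      (isClosed_cspan _) ?_ d
    exact fun z hz hz' => subset_cspan ⟨⟨z, hz'⟩, hz, y, hy, rfl⟩

lemma cspan_range_id {H : Type*} [NormedAddCommGroup H] [NormedSpace ℂ H] :
    cspan (Set.range (_root_.id : H → H)) = ⊤ :=
  eq_top_iff.2 fun x _ => subset_cspan ⟨x, rfl⟩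

lemma adjoint_comp_eq {E V W : Type*} [NormedAddCommGroup E] [NormedSpace ℂ E]
    [NormedAddCommGroup V] [InnerProductSpace ℂ V] [CompleteSpace V]
    [NormedAddCommGroup W] [InnerProductSpace ℂ W] [CompleteSpace W] {U : V →L[ℂ] W}
    (hU : U.adjoint ∘L U = ContinuousLinearMap.id ℂ V) {A : E →L[ℂ] V} {B : E →L[ℂ] W}
    (h : U ∘L A = B) : U.adjoint ∘L B = A := by
  rw [← h, ← ContinuousLinearMap.comp_assoc, hU, ContinuousLinearMap.id_comp]

/-- An isometry `U` belongs to `L(V_κ, W_μ)` if it carries a set `Y` with `[Y] = κ` to a set `U Y`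
with `[U Y] = μ`: then `U* U Y = Y ⊆ κ`, so `U* μ ⊆ κ`. -/
lemma _root_.CFact.IsHom.of_isometry {𝔨 : Type u} [NormedAddCommGroup 𝔨]
    [InnerProductSpace ℂ 𝔨] [CompleteSpace 𝔨] {ℭ : CStarBase 𝔨} {V W : Type u}
    [NormedAddCommGroup V] [InnerProductSpace ℂ V] [CompleteSpace V]
    [NormedAddCommGroup W] [InnerProductSpace ℂ W]
    [CompleteSpace W] {κ : CFact ℭ V} {μ : CFact ℭ W} {U : V →L[ℂ] W}
    (hU : U.adjoint ∘L U = ContinuousLinearMap.id ℂ V) {Y : Set (𝔨 →L[ℂ] V)}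
    (hκ : cspan Y = κ.space) (hμ : cspan {z | ∃ y ∈ Y, U ∘L y = z} = μ.space) :
    κ.IsHom μ U where
  map_mem x hx := by
    rw [← hκ] at hx
    refine cspan_map (ContinuousLinearMap.compL ℂ 𝔨 _ _ U) μ.isClosed_space ?_ hx
    intro y hy
    rw [← hμ]
    exact subset_cspan ⟨y, hy, rfl⟩
  adjoint_mem x hx := by
    rw [← hμ] at hx
    refine cspan_map (ContinuousLinearMap.compL ℂ 𝔨 _ _ U.adjoint) κ.isClosed_space ?_ hx
    rintro _ ⟨y, hy, rfl⟩
    rw [ContinuousLinearMap.compL_apply, adjoint_comp_eq hU rfl, ← hκ]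
    exact subset_cspan hy

end CRel

/-! ### The associator -/

namespace RelTensor

section Assoc

variable {𝔥 : Type u} [NormedAddCommGroup 𝔥] [InnerProductSpace ℂ 𝔥] [CompleteSpace 𝔥]
  {𝔨 : Type u} [NormedAddCommGroup 𝔨] [InnerProductSpace ℂ 𝔨] [CompleteSpace 𝔨]
  {𝔩 : Type u} [NormedAddCommGroup 𝔩] [InnerProductSpace ℂ 𝔩] [CompleteSpace 𝔩]
  {𝔅 : CStarBase 𝔥} {ℭ : CStarBase 𝔨} {𝔇 : CStarBase 𝔩}
  {H : Type u} [NormedAddCommGroup H] [InnerProductSpace ℂ H] [CompleteSpace H]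
  {K : Type u} [NormedAddCommGroup K] [InnerProductSpace ℂ K] [CompleteSpace K]
  {L : Type u} [NormedAddCommGroup L] [InnerProductSpace ℂ L] [CompleteSpace L]

/-- The representation of `ℭ†` induced by `β ◁ δ` acts on the first tensor factor alone. -/
lemma leftTri_rho_ket2 {δ : CFact 𝔅.op K} {α : CFact 𝔅 H} {β : CFact ℭ H} (h : α.Compatible β)
    (c : ℭ.dual.toSubmodule) (η : δ.space) :
    (leftTri δ h).rho c ∘L ket2 α δ η = ket2 α δ η ∘L β.rho c := by
  refine β.ext_op fun b hb ζ => ?_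
  have := (leftTri δ h).rho_apply c (mem_leftTri h η hb) ζ
  simp only [ContinuousLinearMap.comp_apply] at this ⊢
  rw [this, β.rho_apply c hb]

/-- The representation of `ℭ†` induced by `α ▷ γ` acts on the second tensor factor alone. -/
lemma rightTri_rho_ket1 {α : CFact 𝔅 H} {δ : CFact 𝔅.op K} {γ : CFact ℭ K}
    (h : γ.Compatible δ) (c : ℭ.dual.toSubmodule) (ξ : α.space) :
    (rightTri α h).rho c ∘L ket1 α δ ξ = ket1 α δ ξ ∘L γ.rho c := by
  refine γ.ext_op fun b hb ζ => ?_
  have := (rightTri α h).rho_apply c (mem_rightTri h ξ hb) ζ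
  simp only [ContinuousLinearMap.comp_apply] at this ⊢
  rw [this, γ.rho_apply c hb]

/-- The representations of a compatible pair commute: `ρ_β(c) α ⊆ α`, and `ρ_α(b)` multiplies
elements of `α` by `b` from the right. -/
lemma _root_.CFact.Compatible.commute {α : CFact 𝔅 H} {β : CFact ℭ H} (h : α.Compatible β)
    (b : 𝔅.dual.toSubmodule) (c : ℭ.dual.toSubmodule) :
    α.rho b ∘L β.rho c = β.rho c ∘L α.rho b := by
  refine α.ext_op fun ξ hξ ζ => ?_
  simp only [ContinuousLinearMap.comp_apply]
  rw [α.rho_apply b hξ]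
  exact α.rho_apply b (rho_mem h c hξ) ζ

variable {γ : CFact ℭ K} {δ : CFact 𝔅.op K}

lemma inner_ket1 {α : CFact 𝔅 H} (ξ ξ' : α.space) (k k' : K) :
    ⟪ket1 α δ ξ k, ket1 α δ ξ' k'⟫_ℂ = ⟪k, δ.rho ⟨(ξ : 𝔥 →L[ℂ] H).adjoint ∘L (ξ' : 𝔥 →L[ℂ] H),
      α.adjoint_mul_mem ξ.2 ξ'.2⟩ k'⟫_ℂ := by
  rw [← adjoint_ket1, ContinuousLinearMap.comp_apply, ContinuousLinearMap.adjoint_inner_right]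

lemma inner_ket2 {α : CFact 𝔅 H} (η η' : δ.space) (x x' : H) :
    ⟪ket2 α δ η x, ket2 α δ η' x'⟫_ℂ = ⟪x, α.rho ⟨(η : 𝔥 →L[ℂ] K).adjoint ∘L (η' : 𝔥 →L[ℂ] K),
      δ.adjoint_mul_mem η.2 η'.2⟩ x'⟫_ℂ := by
  rw [← adjoint_ket2, ContinuousLinearMap.comp_apply, ContinuousLinearMap.adjoint_inner_right]

/-- Both inner products are `⟪k, ρ_δ(ξ* ξ') ρ_γ(θ* θ') k'⟫`, as the representations `ρ_γ` and `ρ_δ`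
commute. -/
lemma inner_ket2_ket1 (α : CFact 𝔅 H) (h : γ.Compatible δ) (φ : CFact ℭ.op L)
    (ξ ξ' : α.space) (θ θ' : φ.space) (k k' : K) :
    ⟪ket2 (rightTri α h) φ θ (ket1 α δ ξ k), ket2 (rightTri α h) φ θ' (ket1 α δ ξ' k')⟫_ℂ =
      ⟪ket1 α (leftTri φ h) ξ (ket2 γ φ θ k), ket1 α (leftTri φ h) ξ' (ket2 γ φ θ' k')⟫_ℂ := by
  have h1 := fun c => congrArg (fun A => A k') (rightTri_rho_ket1 (α := α) h c ξ')
  have h2 := fun c => congrArg (fun A => A k') (leftTri_rho_ket2 (δ := φ) h c θ')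
  have h3 := fun b c => congrArg (fun A => A k') (h.commute b c)
  simp only [ContinuousLinearMap.comp_apply] at h1 h2 h3
  rw [inner_ket2, inner_ket1, h1, h2, inner_ket1, inner_ket2, h3]

lemma exists_assoc (α : CFact 𝔅 H) (h : γ.Compatible δ) (φ : CFact ℭ.op L) :
    ∃ U : RelTensor (rightTri α h) φ →L[ℂ] RelTensor α (leftTri φ h),
      (∀ i : φ.space × α.space × K, U (ket2 _ φ i.1 (ket1 α δ i.2.1 i.2.2)) =
        ket1 α _ i.2.1 (ket2 γ φ i.1 i.2.2)) ∧
      U.adjoint ∘L U = ContinuousLinearMap.id ℂ _ ∧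
      U ∘L U.adjoint = ContinuousLinearMap.id ℂ _ := by
  have hv := cspan_range_comp (fun ξ => ket1 α δ ξ) (total_ket1 α δ) cspan_range_id
  have hv' := cspan_range_comp (fun θ => ket2 (rightTri α h) φ θ) (total_ket2 _ _) hv
  have hw := cspan_range_comp (fun θ => ket2 γ φ θ) (total_ket2 γ φ) cspan_range_id
  have hw' := cspan_range_comp (fun ξ => ket1 α (leftTri φ h) ξ) (total_ket1 _ _) hw
  refine exists_unitary (fun i : φ.space × α.space × K => ket2 _ φ i.1 (ket1 α δ i.2.1 i.2.2))
    (fun i => ket1 α _ i.2.1 (ket2 γ φ i.1 i.2.2)) hv' ?_ ?_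
  · rw [eq_top_iff, ← hw']
    refine cspan_le (isClosed_cspan _) ?_
    rintro _ ⟨⟨ξ, θ, k⟩, rfl⟩
    exact subset_cspan ⟨(θ, ξ, k), rfl⟩
  · rintro ⟨θ, ξ, k⟩ ⟨θ', ξ', k'⟩
    exact inner_ket2_ket1 α h φ ξ ξ' θ θ' k k'

/-- The associator `(H _α⊗_δ K) _{α▷γ}⊗_φ L → H _α⊗_{δ◁φ} (K _γ⊗_φ L)`,
`|θ⟩₂ |ξ⟩₁ k ↦ |ξ⟩₁ |θ⟩₂ k`. -/
def assoc (α : CFact 𝔅 H) (h : γ.Compatible δ) (φ : CFact ℭ.op L) :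
    RelTensor (rightTri α h) φ →L[ℂ] RelTensor α (leftTri φ h) :=
  Classical.choose (exists_assoc α h φ)

variable (α : CFact 𝔅 H) (h : γ.Compatible δ) (φ : CFact ℭ.op L)

lemma assoc_apply (ξ : α.space) (k : K) (θ : φ.space) :
    assoc α h φ (ket2 (rightTri α h) φ θ (ket1 α δ ξ k)) =
      ket1 α (leftTri φ h) ξ (ket2 γ φ θ k) :=
  (Classical.choose_spec (exists_assoc α h φ)).1 (θ, ξ, k)

lemma adjoint_comp_assoc :
    (assoc α h φ).adjoint ∘L assoc α h φ = ContinuousLinearMap.id ℂ _ :=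
  (Classical.choose_spec (exists_assoc α h φ)).2.1

lemma assoc_comp_adjoint :
    assoc α h φ ∘L (assoc α h φ).adjoint = ContinuousLinearMap.id ℂ _ :=
  (Classical.choose_spec (exists_assoc α h φ)).2.2

/-- `a |θ⟩₂ |η⟩₂ = ||θ⟩₂ η⟩₂`: the associator carries generators of `(β ◁ δ) ◁ φ` to generators
of `β ◁ (δ ◁ φ)`. -/
lemma assoc_ket2 (θ : φ.space) (η : δ.space) :
    assoc α h φ ∘L (ket2 (rightTri α h) φ θ ∘L ket2 α δ η) =
      ket2 α (leftTri φ h) ⟨ket2 γ φ θ ∘L (η : 𝔥 →L[ℂ] K), mem_leftTri h θ η.2⟩ := by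
  refine α.ext_op fun ξ hξ ζ => ?_
  simp only [ContinuousLinearMap.comp_apply]
  rw [ket2_apply' _ hξ, ket2_apply' _ hξ, ← ket1_apply, assoc_apply, ← ket1_apply]
  rfl

/-- `a ||ξ⟩₁ c⟩₁ = |ξ⟩₁ |c⟩₁`: the associator carries generators of `(α ▷ γ) ▷ ε` to generators
of `α ▷ (γ ▷ ε)`. -/
lemma assoc_ket1 (ξ : α.space) (c : γ.space) :
    assoc α h φ ∘L ket1 (rightTri α h) φ ⟨ket1 α δ ξ ∘L (c : 𝔨 →L[ℂ] K), mem_rightTri h ξ c.2⟩ =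
      ket1 α (leftTri φ h) ξ ∘L ket1 γ φ c := by
  refine φ.ext_op fun θ hθ ζ => ?_
  simp only [ContinuousLinearMap.comp_apply]
  rw [ket1_apply' _ hθ, ket1_apply' _ hθ, ← ket2_apply, ← ket2_apply]
  exact assoc_apply α h φ ξ _ ⟨θ, hθ⟩

variable {α φ}

lemma isHom_assoc_left {β : CFact 𝔇 H} (h' : α.Compatible β) :
    (leftTri φ (compatible_tri h' h)).IsHom (leftTri (leftTri φ h) h') (assoc α h φ) := by
  refine .of_isometry (adjoint_comp_assoc α h φ)
    (cspan_comp_cspan (fun θ => ket2 (rightTri α h) φ θ) _) ?_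
  have hg := cspan_cspan_comp (𝔩 := 𝔩) (H := H) (V := RelTensor α (leftTri φ h))
    (D := (leftTri φ h).space) (leftTri_space φ h).symm (ket2 α (leftTri φ h)) β.space
  refine Eq.trans ?_ hg
  congr 1
  ext z
  constructor
  · rintro ⟨_, ⟨θ, _, ⟨η, b, hb, rfl⟩, rfl⟩, rfl⟩
    refine ⟨⟨_, mem_leftTri h θ η.2⟩, ⟨θ, η, η.2, rfl⟩, b, hb, ?_⟩
    exact (congrArg (fun A => A ∘L b) (assoc_ket2 α h φ θ η)).symm
  · rintro ⟨⟨_, hd⟩, ⟨θ, η, hη, rfl⟩, b, hb, rfl⟩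
    refine ⟨_, ⟨θ, _, ⟨⟨η, hη⟩, b, hb, rfl⟩, rfl⟩, ?_⟩
    exact congrArg (fun A => A ∘L b) (assoc_ket2 α h φ θ ⟨η, hη⟩)

lemma isHom_assoc_right {ε : CFact 𝔇 L} (h' : ε.Compatible φ) :
    (rightTri (rightTri α h) h').IsHom (rightTri α (compatible_tri h h')) (assoc α h φ) := by
  have hg := cspan_cspan_comp (𝔩 := 𝔩) (H := L) (V := RelTensor (rightTri α h) φ)
    (D := (rightTri α h).space) (rightTri_space α h).symm (ket1 (rightTri α h) φ) ε.space
  refine .of_isometry (adjoint_comp_assoc α h φ) hg ?_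
  refine Eq.trans ?_ (cspan_comp_cspan (fun ξ => ket1 α (leftTri φ h) ξ) _)
  congr 1
  ext z
  constructor
  · rintro ⟨_, ⟨⟨_, hd⟩, ⟨ξ, c, hc, rfl⟩, e, he, rfl⟩, rfl⟩
    refine ⟨ξ, _, ⟨⟨c, hc⟩, e, he, rfl⟩, ?_⟩
    exact (congrArg (fun A => A ∘L e) (assoc_ket1 α h φ ξ ⟨c, hc⟩)).symm
  · rintro ⟨ξ, _, ⟨c, e, he, rfl⟩, rfl⟩
    refine ⟨_, ⟨⟨_, mem_rightTri h ξ c.2⟩, ⟨ξ, c, c.2, rfl⟩, e, he, rfl⟩, ?_⟩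
    exact congrArg (fun A => A ∘L e) (assoc_ket1 α h φ ξ c)

end Assoc

/-! ### The unitors -/

section Unitors

variable {𝔥 : Type u} [NormedAddCommGroup 𝔥] [InnerProductSpace ℂ 𝔥] [CompleteSpace 𝔥]
  {𝔨 : Type u} [NormedAddCommGroup 𝔨] [InnerProductSpace ℂ 𝔨] [CompleteSpace 𝔨]
  {𝔅 : CStarBase 𝔥} {ℭ : CStarBase 𝔨}
  {H : Type u} [NormedAddCommGroup H] [InnerProductSpace ℂ H] [CompleteSpace H]

/-- `[α 𝔅† 𝔥] = H`, as `𝔅†` is nondegenerate. -/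
lemma _root_.CFact.total_dual (α : CFact 𝔅 H) :
    cspan (Set.range fun i : α.space × 𝔅.dual × 𝔥 =>
      (i.1 : 𝔥 →L[ℂ] H) ((i.2.1 : 𝔥 →L[ℂ] 𝔥) i.2.2)) = ⊤ := by
  refine cspan_range_comp (fun ξ : α.space => (ξ : 𝔥 →L[ℂ] H)) ?_
    (g := fun i : 𝔅.dual × 𝔥 => (i.1 : 𝔥 →L[ℂ] 𝔥) i.2) ?_
  · rw [← α.total]
    congr 1
    ext z
    simp
  · rw [← 𝔅.dual_nondegenerate]
    congr 1
    ext z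
    simp

/-- The Gram matrices of `b ⊗ ζ ⊗ ξ` and `ξ b ζ` agree because `ξ* ξ' ∈ 𝔅†` commutes with `𝔅`. -/
lemma exists_leftUnitor (β : CFact 𝔅.op H) :
    ∃ U : RelTensor (CFact.self 𝔅) β →L[ℂ] H,
      (∀ i : (CFact.self 𝔅).space × 𝔥 × β.space, U (tmul i.1 i.2.1 i.2.2) =
        (i.2.2 : 𝔥 →L[ℂ] H) ((i.1 : 𝔥 →L[ℂ] 𝔥) i.2.1)) ∧
      U.adjoint ∘L U = ContinuousLinearMap.id ℂ _ ∧
      U ∘L U.adjoint = ContinuousLinearMap.id ℂ _ := by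
  refine exists_unitary _ _ (total _ _) ?_ ?_
  · rw [eq_top_iff, ← β.total_dual]
    refine cspan_le (isClosed_cspan _) ?_
    rintro _ ⟨⟨ξ, b, ζ⟩, rfl⟩
    exact subset_cspan ⟨(b, ζ, ξ), rfl⟩
  · rintro ⟨b, ζ, ξ⟩ ⟨b', ζ', ξ'⟩
    rw [inner_tmul, ← ContinuousLinearMap.adjoint_inner_right (ξ : 𝔥 →L[ℂ] H)]
    exact congrArg (fun A : 𝔥 →L[ℂ] 𝔥 => ⟪(b : 𝔥 →L[ℂ] 𝔥) ζ, A ζ'⟫_ℂ)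
      (𝔅.commute _ b'.2 _ (β.adjoint_mul_mem ξ.2 ξ'.2)).eq

/-- The Gram matrices of `ξ ⊗ ζ ⊗ b` and `ξ b ζ` agree because `ξ* ξ' ∈ 𝔅` commutes with `𝔅†`. -/
lemma exists_rightUnitor (α : CFact 𝔅 H) :
    ∃ U : RelTensor α (CFact.self 𝔅.op) →L[ℂ] H,
      (∀ i : α.space × 𝔥 × (CFact.self 𝔅.op).space, U (tmul i.1 i.2.1 i.2.2) =
        (i.1 : 𝔥 →L[ℂ] H) ((i.2.2 : 𝔥 →L[ℂ] 𝔥) i.2.1)) ∧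
      U.adjoint ∘L U = ContinuousLinearMap.id ℂ _ ∧
      U ∘L U.adjoint = ContinuousLinearMap.id ℂ _ := by
  refine exists_unitary _ _ (total _ _) ?_ ?_
  · rw [eq_top_iff, ← α.total_dual]
    refine cspan_le (isClosed_cspan _) ?_
    rintro _ ⟨⟨ξ, b, ζ⟩, rfl⟩
    exact subset_cspan ⟨(ξ, ζ, b), rfl⟩
  · rintro ⟨ξ, ζ, b⟩ ⟨ξ', ζ', b'⟩
    have hc := 𝔅.commute _ (α.adjoint_mul_mem ξ.2 ξ'.2) _ (star_mem b.2)
    have hc' := congrArg (fun A : 𝔥 →L[ℂ] 𝔥 => A ((b' : 𝔥 →L[ℂ] 𝔥) ζ')) hc.eq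
    rw [inner_tmul, ← ContinuousLinearMap.adjoint_inner_right (ξ : 𝔥 →L[ℂ] H),
      ← ContinuousLinearMap.adjoint_inner_right (ξ : 𝔥 →L[ℂ] H),
      ← ContinuousLinearMap.adjoint_inner_right (b : 𝔥 →L[ℂ] 𝔥)]
    exact congrArg (fun z => ⟪ζ, z⟫_ℂ) hc'

/-- The left unitor `𝔥 _𝔅⊗_β H → H`, `b ⊗ ζ ⊗ ξ ↦ ξ b ζ`. -/
def leftUnitor (β : CFact 𝔅.op H) : RelTensor (CFact.self 𝔅) β →L[ℂ] H :=
  Classical.choose (exists_leftUnitor β)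

/-- The right unitor `H _α⊗_{𝔅†} 𝔥 → H`, `ξ ⊗ ζ ⊗ b ↦ ξ b ζ`. -/
def rightUnitor (α : CFact 𝔅 H) : RelTensor α (CFact.self 𝔅.op) →L[ℂ] H :=
  Classical.choose (exists_rightUnitor α)

variable (β : CFact 𝔅.op H) (α : CFact 𝔅 H)

lemma leftUnitor_tmul (b : (CFact.self 𝔅).space) (ζ : 𝔥) (ξ : β.space) :
    leftUnitor β (tmul b ζ ξ) = (ξ : 𝔥 →L[ℂ] H) ((b : 𝔥 →L[ℂ] 𝔥) ζ) :=
  (Classical.choose_spec (exists_leftUnitor β)).1 (b, ζ, ξ)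

lemma adjoint_comp_leftUnitor :
    (leftUnitor β).adjoint ∘L leftUnitor β = ContinuousLinearMap.id ℂ _ :=
  (Classical.choose_spec (exists_leftUnitor β)).2.1

lemma leftUnitor_comp_adjoint :
    leftUnitor β ∘L (leftUnitor β).adjoint = ContinuousLinearMap.id ℂ _ :=
  (Classical.choose_spec (exists_leftUnitor β)).2.2

lemma rightUnitor_tmul (ξ : α.space) (ζ : 𝔥) (b : (CFact.self 𝔅.op).space) :
    rightUnitor α (tmul ξ ζ b) = (ξ : 𝔥 →L[ℂ] H) ((b : 𝔥 →L[ℂ] 𝔥) ζ) :=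
  (Classical.choose_spec (exists_rightUnitor α)).1 (ξ, ζ, b)

lemma adjoint_comp_rightUnitor :
    (rightUnitor α).adjoint ∘L rightUnitor α = ContinuousLinearMap.id ℂ _ :=
  (Classical.choose_spec (exists_rightUnitor α)).2.1

lemma rightUnitor_comp_adjoint :
    rightUnitor α ∘L (rightUnitor α).adjoint = ContinuousLinearMap.id ℂ _ :=
  (Classical.choose_spec (exists_rightUnitor α)).2.2

lemma leftUnitor_ket2 (ξ : β.space) :
    leftUnitor β ∘L ket2 (CFact.self 𝔅) β ξ = (ξ : 𝔥 →L[ℂ] H) := by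
  refine (CFact.self 𝔅).ext_op fun b hb ζ => ?_
  rw [ContinuousLinearMap.comp_apply, ket2_apply' _ hb, leftUnitor_tmul]

lemma leftUnitor_ket1 (b : (CFact.self 𝔅).space) :
    leftUnitor β ∘L ket1 (CFact.self 𝔅) β b = β.rho b := by
  refine β.ext_op fun ξ hξ ζ => ?_
  rw [ContinuousLinearMap.comp_apply, ket1_apply' _ hξ, leftUnitor_tmul]
  exact (β.rho_apply b hξ ζ).symm

lemma rightUnitor_ket1 (ξ : α.space) :
    rightUnitor α ∘L ket1 α (CFact.self 𝔅.op) ξ = (ξ : 𝔥 →L[ℂ] H) := by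
  refine (CFact.self 𝔅.op).ext_op fun b hb ζ => ?_
  rw [ContinuousLinearMap.comp_apply, ket1_apply' _ hb, rightUnitor_tmul]

lemma rightUnitor_ket2 (b : (CFact.self 𝔅.op).space) :
    rightUnitor α ∘L ket2 α (CFact.self 𝔅.op) b = α.rho b := by
  refine α.ext_op fun ξ hξ ζ => ?_
  rw [ContinuousLinearMap.comp_apply, ket2_apply' _ hξ, rightUnitor_tmul]
  exact (α.rho_apply b hξ ζ).symm

variable {β α}

lemma isHom_leftUnitor_left :
    (leftTri β (CFact.compatible_self 𝔅)).IsHom β (leftUnitor β) := by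
  refine .of_isometry (adjoint_comp_leftUnitor β) (leftTri_space _ _).symm (Eq.trans ?_ β.mul_alg)
  congr 1
  ext z
  constructor
  · rintro ⟨_, ⟨ξ, b, hb, rfl⟩, rfl⟩
    exact ⟨ξ, ξ.2, b, hb, (congrArg (fun A => A ∘L b) (leftUnitor_ket2 β ξ)).symm⟩
  · rintro ⟨ξ, hξ, b, hb, rfl⟩
    exact ⟨_, ⟨⟨ξ, hξ⟩, b, hb, rfl⟩, congrArg (fun A => A ∘L b) (leftUnitor_ket2 β ⟨ξ, hξ⟩)⟩

lemma isHom_leftUnitor_right {α : CFact ℭ H} (h : α.Compatible β) :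
    (rightTri (CFact.self 𝔅) h).IsHom α (leftUnitor β) := by
  refine .of_isometry (adjoint_comp_leftUnitor β) (rightTri_space _ _).symm (Eq.trans ?_ h.right)
  congr 1
  ext z
  constructor
  · rintro ⟨_, ⟨b, ξ, hξ, rfl⟩, rfl⟩
    exact ⟨b, ξ, hξ, (congrArg (fun A => A ∘L ξ) (leftUnitor_ket1 β b)).symm⟩
  · rintro ⟨b, ξ, hξ, rfl⟩
    exact ⟨_, ⟨b, ξ, hξ, rfl⟩, congrArg (fun A => A ∘L ξ) (leftUnitor_ket1 β b)⟩

lemma isHom_rightUnitor_right :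
    (rightTri α (CFact.compatible_self 𝔅)).IsHom α (rightUnitor α) := by
  refine .of_isometry (adjoint_comp_rightUnitor α) (rightTri_space _ _).symm (Eq.trans ?_ α.mul_alg)
  congr 1
  ext z
  constructor
  · rintro ⟨_, ⟨ξ, b, hb, rfl⟩, rfl⟩
    exact ⟨ξ, ξ.2, b, hb, (congrArg (fun A => A ∘L b) (rightUnitor_ket1 α ξ)).symm⟩
  · rintro ⟨ξ, hξ, b, hb, rfl⟩
    exact ⟨_, ⟨⟨ξ, hξ⟩, b, hb, rfl⟩, congrArg (fun A => A ∘L b) (rightUnitor_ket1 α ⟨ξ, hξ⟩)⟩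

lemma isHom_rightUnitor_left {β : CFact ℭ H} (h : α.Compatible β) :
    (leftTri (CFact.self 𝔅.op) h).IsHom β (rightUnitor α) := by
  refine .of_isometry (adjoint_comp_rightUnitor α) (leftTri_space _ _).symm (Eq.trans ?_ h.left)
  congr 1
  ext z
  constructor
  · rintro ⟨_, ⟨b, ξ, hξ, rfl⟩, rfl⟩
    exact ⟨b, ξ, hξ, (congrArg (fun A => A ∘L ξ) (rightUnitor_ket2 α b)).symm⟩
  · rintro ⟨b, ξ, hξ, rfl⟩
    exact ⟨_, ⟨b, ξ, hξ, rfl⟩, congrArg (fun A => A ∘L ξ) (rightUnitor_ket2 α b)⟩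

end Unitors

end RelTensor

/-! ### Structure isomorphisms and coherence -/

namespace CBimod

open CategoryTheory

section Structure

variable {𝔥 : Type u} [NormedAddCommGroup 𝔥] [InnerProductSpace ℂ 𝔥] [CompleteSpace 𝔥]
  {𝔨 : Type u} [NormedAddCommGroup 𝔨] [InnerProductSpace ℂ 𝔨] [CompleteSpace 𝔨]
  {𝔩 : Type u} [NormedAddCommGroup 𝔩] [InnerProductSpace ℂ 𝔩] [CompleteSpace 𝔩]
  {𝔪 : Type u} [NormedAddCommGroup 𝔪] [InnerProductSpace ℂ 𝔪] [CompleteSpace 𝔪]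
  {𝔫 : Type u} [NormedAddCommGroup 𝔫] [InnerProductSpace ℂ 𝔫] [CompleteSpace 𝔫]
  {𝔅 : CStarBase 𝔥} {ℭ : CStarBase 𝔨} {𝔇 : CStarBase 𝔩} {𝔈 : CStarBase 𝔪} {𝔉 : CStarBase 𝔫}

lemma comp_apply {X Y Z : CBimod 𝔅 ℭ} (f : X ⟶ Y) (g : Y ⟶ Z) (x : X.carrier) :
    (f ≫ g).toOp x = g.toOp (f.toOp x) := rfl

/-- A unitary morphism is an isomorphism, with its adjoint as the inverse. -/
def isoOfUnitary {X Y : CBimod 𝔅 ℭ} (f : X ⟶ Y) (hf : f.IsUnitary) : X ≅ Y where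
  hom := f
  inv := ⟨f.toOp.adjoint, f.isHom_right.adjoint, f.isHom_left.adjoint⟩
  hom_inv_id := Hom.ext hf.1
  inv_hom_id := Hom.ext hf.2

/-- The associator as an isomorphism of bimodules. -/
def assocIso (X : CBimod 𝔅 ℭ) (Y : CBimod ℭ 𝔇) (Z : CBimod 𝔇 𝔈) :
    tensorObj (tensorObj X Y) Z ≅ tensorObj X (tensorObj Y Z) :=
  isoOfUnitary
    ⟨RelTensor.assoc X.right Y.compatible Z.left,
      RelTensor.isHom_assoc_right Y.compatible Z.compatible,
      RelTensor.isHom_assoc_left Y.compatible X.compatible⟩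
    ⟨RelTensor.adjoint_comp_assoc _ _ _, RelTensor.assoc_comp_adjoint _ _ _⟩

/-- The left unitor as an isomorphism of bimodules. -/
def leftUnitorIso (X : CBimod 𝔅 ℭ) : tensorObj (unit 𝔅) X ≅ X :=
  isoOfUnitary
    ⟨RelTensor.leftUnitor X.left, RelTensor.isHom_leftUnitor_right X.compatible,
      RelTensor.isHom_leftUnitor_left⟩
    ⟨RelTensor.adjoint_comp_leftUnitor _, RelTensor.leftUnitor_comp_adjoint _⟩

/-- The right unitor as an isomorphism of bimodules. -/
def rightUnitorIso (X : CBimod 𝔅 ℭ) : tensorObj X (unit ℭ) ≅ X :=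
  isoOfUnitary
    ⟨RelTensor.rightUnitor X.right, RelTensor.isHom_rightUnitor_right,
      RelTensor.isHom_rightUnitor_left X.compatible⟩
    ⟨RelTensor.adjoint_comp_rightUnitor _, RelTensor.rightUnitor_comp_adjoint _⟩

lemma isUnitary_assocIso (X : CBimod 𝔅 ℭ) (Y : CBimod ℭ 𝔇) (Z : CBimod 𝔇 𝔈) :
    Hom.IsUnitary (assocIso X Y Z).hom :=
  ⟨RelTensor.adjoint_comp_assoc _ _ _, RelTensor.assoc_comp_adjoint _ _ _⟩

lemma isUnitary_leftUnitorIso (X : CBimod 𝔅 ℭ) : Hom.IsUnitary (leftUnitorIso X).hom :=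
  ⟨RelTensor.adjoint_comp_leftUnitor _, RelTensor.leftUnitor_comp_adjoint _⟩

lemma isUnitary_rightUnitorIso (X : CBimod 𝔅 ℭ) : Hom.IsUnitary (rightUnitorIso X).hom :=
  ⟨RelTensor.adjoint_comp_rightUnitor _, RelTensor.rightUnitor_comp_adjoint _⟩

/-- Morphisms out of `X ⊙ Y` are determined on the vectors `|ξ⟩₁ k`. -/
lemma hom_ext_ket1 {X : CBimod 𝔅 ℭ} {Y : CBimod ℭ 𝔇} {V : CBimod 𝔅 𝔇}
    {f g : tensorObj X Y ⟶ V}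
    (h : ∀ (ξ : X.right.space) (k : Y.carrier), f.toOp (ket1 X Y ξ k) = g.toOp (ket1 X Y ξ k)) :
    f = g := by
  refine Hom.ext (ext_total (RelTensor.total_ket1 X.right Y.left) ?_)
  rintro _ ⟨ξ, k, rfl⟩
  exact h ξ k

/-- Morphisms out of `X ⊙ Y` are determined on the vectors `|η⟩₂ x`, with `x` from a total
subset. -/
lemma hom_ext_ket2 {X : CBimod 𝔅 ℭ} {Y : CBimod ℭ 𝔇} {V : CBimod 𝔅 𝔇}
    {f g : tensorObj X Y ⟶ V} {S : Set X.carrier} (hS : cspan S = ⊤)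
    (h : ∀ (η : Y.left.space), ∀ x ∈ S, f.toOp (ket2 X Y η x) = g.toOp (ket2 X Y η x)) :
    f = g := by
  refine Hom.ext (ext_total (RelTensor.total_ket2 X.right Y.left) ?_)
  rintro _ ⟨η, x, rfl⟩
  exact congrArg (fun A => A x) (ext_total (A := f.toOp ∘L ket2 X Y η)
    (B := g.toOp ∘L ket2 X Y η) hS (h η))

/-- Morphisms out of `(X ⊙ Y) ⊙ Z` are determined on the vectors `|θ⟩₂ |ξ⟩₁ k`. -/
lemma hom_ext_ket2_ket1 {X : CBimod 𝔅 ℭ} {Y : CBimod ℭ 𝔇} {Z : CBimod 𝔇 𝔈} {V : CBimod 𝔅 𝔈}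
    {f g : tensorObj (tensorObj X Y) Z ⟶ V}
    (h : ∀ (θ : Z.left.space) (ξ : X.right.space) (k : Y.carrier),
      f.toOp (ket2 (tensorObj X Y) Z θ (ket1 X Y ξ k)) =
        g.toOp (ket2 (tensorObj X Y) Z θ (ket1 X Y ξ k))) :
    f = g := by
  refine hom_ext_ket2 (RelTensor.total_ket1 X.right Y.left) ?_
  rintro θ _ ⟨ξ, k, rfl⟩
  exact h θ ξ k

lemma tensorHom_ket1 {X X' : CBimod 𝔅 ℭ} {Y Y' : CBimod ℭ 𝔇} (S : X ⟶ X') (T : Y ⟶ Y')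
    (ξ : X.right.space) (k : Y.carrier) :
    (tensorHom S T).toOp (ket1 X Y ξ k) =
      ket1 X' Y' ⟨S.toOp ∘L (ξ : 𝔨 →L[ℂ] X.carrier), S.isHom_right.map_mem _ ξ.2⟩ (T.toOp k) :=
  congrArg (fun A => A k) (RelTensor.map_ket1 S.isHom_right T.isHom_left ξ)

lemma tensorHom_ket2 {X X' : CBimod 𝔅 ℭ} {Y Y' : CBimod ℭ 𝔇} (S : X ⟶ X') (T : Y ⟶ Y')
    (η : Y.left.space) (x : X.carrier) :
    (tensorHom S T).toOp (ket2 X Y η x) =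
      ket2 X' Y' ⟨T.toOp ∘L (η : 𝔨 →L[ℂ] Y.carrier), T.isHom_left.map_mem _ η.2⟩ (S.toOp x) :=
  congrArg (fun A => A x) (RelTensor.map_ket2 S.isHom_right T.isHom_left η)

lemma assocIso_apply (X : CBimod 𝔅 ℭ) (Y : CBimod ℭ 𝔇) (Z : CBimod 𝔇 𝔈)
    (ξ : X.right.space) (k : Y.carrier) (θ : Z.left.space) :
    (assocIso X Y Z).hom.toOp (ket2 (tensorObj X Y) Z θ (ket1 X Y ξ k)) =
      ket1 X (tensorObj Y Z) ξ (ket2 Y Z θ k) :=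
  RelTensor.assoc_apply X.right Y.compatible Z.left ξ k θ

lemma assocIso_ket2 (X : CBimod 𝔅 ℭ) (Y : CBimod ℭ 𝔇) (Z : CBimod 𝔇 𝔈)
    (θ : Z.left.space) (η : Y.left.space) (x : X.carrier) :
    (assocIso X Y Z).hom.toOp (ket2 (tensorObj X Y) Z θ (ket2 X Y η x)) =
      ket2 X (tensorObj Y Z) ⟨ket2 Y Z θ ∘L (η : 𝔨 →L[ℂ] Y.carrier),
        RelTensor.mem_leftTri Y.compatible θ η.2⟩ x :=
  congrArg (fun A => A x) (RelTensor.assoc_ket2 X.right Y.compatible Z.left θ η)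


lemma leftUnitorIso_ket2 (X : CBimod 𝔅 ℭ) (ξ : X.left.space) (ζ : (unit 𝔅).carrier) :
    (leftUnitorIso X).hom.toOp (ket2 (unit 𝔅) X ξ ζ) = (ξ : 𝔥 →L[ℂ] X.carrier) ζ :=
  congrArg (fun A => A ζ) (RelTensor.leftUnitor_ket2 X.left ξ)

lemma rightUnitorIso_ket1 (X : CBimod 𝔅 ℭ) (ξ : X.right.space) (ζ : (unit ℭ).carrier) :
    (rightUnitorIso X).hom.toOp (ket1 X (unit ℭ) ξ ζ) = (ξ : 𝔨 →L[ℂ] X.carrier) ζ :=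
  congrArg (fun A => A ζ) (RelTensor.rightUnitor_ket1 X.right ξ)

lemma tensorHom_id_id (X : CBimod 𝔅 ℭ) (Y : CBimod ℭ 𝔇) :
    tensorHom (𝟙 X) (𝟙 Y) = 𝟙 (tensorObj X Y) :=
  hom_ext_ket1 fun ξ k => tensorHom_ket1 _ _ ξ k

lemma tensorHom_comp {X X' X'' : CBimod 𝔅 ℭ} {Y Y' Y'' : CBimod ℭ 𝔇} (S : X ⟶ X') (T : Y ⟶ Y')
    (S' : X' ⟶ X'') (T' : Y' ⟶ Y'') :
    tensorHom S T ≫ tensorHom S' T' = tensorHom (S ≫ S') (T ≫ T') := by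
  refine hom_ext_ket1 fun ξ k => ?_
  rw [comp_apply, tensorHom_ket1, tensorHom_ket1, tensorHom_ket1]
  rfl

lemma assocIso_naturality {X X' : CBimod 𝔅 ℭ} {Y Y' : CBimod ℭ 𝔇} {Z Z' : CBimod 𝔇 𝔈}
    (R : X ⟶ X') (S : Y ⟶ Y') (T : Z ⟶ Z') :
    tensorHom (tensorHom R S) T ≫ (assocIso X' Y' Z').hom =
      (assocIso X Y Z).hom ≫ tensorHom R (tensorHom S T) := by
  refine hom_ext_ket2_ket1 fun θ ξ k => ?_
  rw [comp_apply, comp_apply, tensorHom_ket2, tensorHom_ket1, assocIso_apply, assocIso_apply,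
    tensorHom_ket1, tensorHom_ket2]

lemma leftUnitorIso_naturality {X Y : CBimod 𝔅 ℭ} (T : X ⟶ Y) :
    tensorHom (𝟙 (unit 𝔅)) T ≫ (leftUnitorIso Y).hom = (leftUnitorIso X).hom ≫ T := by
  -- the vectors `|η⟩₂ ζ` are preferable to `|b⟩₁ x` here, since `l |η⟩₂ = η`
  refine hom_ext_ket2 (S := Set.univ) (eq_top_iff.2 fun x _ => subset_cspan trivial)
    fun η ζ _ => ?_
  rw [comp_apply, comp_apply, tensorHom_ket2, leftUnitorIso_ket2, leftUnitorIso_ket2]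
  rfl

lemma rightUnitorIso_naturality {X Y : CBimod 𝔅 ℭ} (S : X ⟶ Y) :
    tensorHom S (𝟙 (unit ℭ)) ≫ (rightUnitorIso Y).hom = (rightUnitorIso X).hom ≫ S := by
  refine hom_ext_ket1 fun ξ ζ => ?_
  rw [comp_apply, comp_apply, tensorHom_ket1, rightUnitorIso_ket1, rightUnitorIso_ket1]
  rfl

/-- Both sides send `|θ⟩₂ |η⟩₂ |ω⟩₁ x` to `|ω⟩₁ ||θ⟩₂ η⟩₂ x`. -/
lemma pentagon (W : CBimod 𝔅 ℭ) (X : CBimod ℭ 𝔇) (Y : CBimod 𝔇 𝔈) (Z : CBimod 𝔈 𝔉) :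
    tensorHom (assocIso W X Y).hom (𝟙 Z) ≫ (assocIso W (tensorObj X Y) Z).hom ≫
        tensorHom (𝟙 W) (assocIso X Y Z).hom =
      (assocIso (tensorObj W X) Y Z).hom ≫ (assocIso W X (tensorObj Y Z)).hom := by
  have h1 := cspan_range_comp (fun ω => ket1 W X ω) (RelTensor.total_ket1 _ _) cspan_range_id
  have h2 := cspan_range_comp (fun η => ket2 (tensorObj W X) Y η) (RelTensor.total_ket2 _ _) h1
  refine hom_ext_ket2 h2 ?_
  rintro θ _ ⟨⟨η, ω, x⟩, rfl⟩
  simp only [comp_apply]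
  rw [assocIso_ket2, assocIso_apply, tensorHom_ket2, assocIso_apply]
  refine (congrArg _ (assocIso_apply W (tensorObj X Y) Z ω (ket2 X Y η x) θ)).trans ?_
  rw [tensorHom_ket1, assocIso_ket2]
  rfl

/-- Both sides send `|η⟩₂ |ξ⟩₁ ζ` to `ξ ⊗ ζ ⊗ η`. -/
lemma triangle (X : CBimod 𝔅 ℭ) (Y : CBimod ℭ 𝔇) :
    (assocIso X (unit ℭ) Y).hom ≫ tensorHom (𝟙 X) (leftUnitorIso Y).hom =
      tensorHom (rightUnitorIso X).hom (𝟙 Y) := by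
  refine hom_ext_ket2_ket1 fun η ξ ζ => ?_
  rw [comp_apply, assocIso_apply, tensorHom_ket1, tensorHom_ket2, leftUnitorIso_ket2,
    rightUnitorIso_ket1]
  exact (RelTensor.ket1_apply ξ η ζ).trans (RelTensor.ket2_apply η ξ ζ).symm

end Structure

variable {𝔥 : Type u} [NormedAddCommGroup 𝔥] [InnerProductSpace ℂ 𝔥] [CompleteSpace 𝔥]

/-- The monoidal category of `C*`-bimodules over a `C*`-base. -/
@[reducible]
def monoidalCategory (𝔅 : CStarBase 𝔥) : MonoidalCategory (CBimod 𝔅 𝔅) :=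
  letI := monoidalStruct (𝔅 := 𝔅) assocIso leftUnitorIso rightUnitorIso
  MonoidalCategory.ofTensorHom
    (id_tensorHom_id := fun X Y => tensorHom_id_id X Y)
    (id_tensorHom := fun _ _ _ _ => rfl)
    (tensorHom_id := fun _ _ => rfl)
    (tensorHom_comp_tensorHom := fun f₁ f₂ g₁ g₂ => tensorHom_comp f₁ f₂ g₁ g₂)
    (associator_naturality := fun f₁ f₂ f₃ => assocIso_naturality f₁ f₂ f₃)
    (leftUnitor_naturality := fun f => leftUnitorIso_naturality f)
    (rightUnitor_naturality := fun f => rightUnitorIso_naturality f)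
    (pentagon := fun W X Y Z => pentagon W X Y Z)
    (triangle := fun X Y => triangle X Y)

end CBimod

end

theorem mainTheorem3 {𝔥 : Type u} [NormedAddCommGroup 𝔥] [InnerProductSpace ℂ 𝔥]
    [CompleteSpace 𝔥] (𝔅 : CStarBase 𝔥) :
    ∃ (a : ∀ X Y Z : CBimod 𝔅 𝔅, CategoryTheory.Iso
          (CBimod.tensorObj (CBimod.tensorObj X Y) Z) (CBimod.tensorObj X (CBimod.tensorObj Y Z)))
      (l : ∀ X : CBimod 𝔅 𝔅, CategoryTheory.Iso (CBimod.tensorObj (CBimod.unit 𝔅) X) X)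
      (r : ∀ X : CBimod 𝔅 𝔅, CategoryTheory.Iso (CBimod.tensorObj X (CBimod.unit 𝔅)) X),
      (∀ X Y Z : CBimod 𝔅 𝔅, CBimod.Hom.IsUnitary (a X Y Z).hom ∧
        ∀ (ξ : X.right.space) (k : Y.carrier) (θ : Z.left.space),
          (a X Y Z).hom.toOp
              (CBimod.ket2 (CBimod.tensorObj X Y) Z θ (CBimod.ket1 X Y ξ k)) =
            CBimod.ket1 X (CBimod.tensorObj Y Z) ξ (CBimod.ket2 Y Z θ k)) ∧
      (∀ X : CBimod 𝔅 𝔅, CBimod.Hom.IsUnitary (l X).hom ∧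
        ∀ (b : 𝔥 →L[ℂ] 𝔥) (hb : b ∈ 𝔅.alg) (ζ : 𝔥) (ξ : X.left.space),
          (l X).hom.toOp (CBimod.tmul (CBimod.unit 𝔅) X ⟨b, hb⟩ ζ ξ) =
            (ξ : 𝔥 →L[ℂ] X.carrier) (b ζ)) ∧
      (∀ X : CBimod 𝔅 𝔅, CBimod.Hom.IsUnitary (r X).hom ∧
        ∀ (ξ : X.right.space) (ζ : 𝔥) (b : 𝔥 →L[ℂ] 𝔥) (hb : b ∈ 𝔅.dual),
          (r X).hom.toOp (CBimod.tmul X (CBimod.unit 𝔅) ξ ζ ⟨b, hb⟩) =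
            (ξ : 𝔥 →L[ℂ] X.carrier) (b ζ)) ∧
      ∃ M : CategoryTheory.MonoidalCategory (CBimod 𝔅 𝔅),
        M.toMonoidalCategoryStruct = CBimod.monoidalStruct a l r :=
  ⟨CBimod.assocIso, CBimod.leftUnitorIso, CBimod.rightUnitorIso,
    fun X Y Z => ⟨CBimod.isUnitary_assocIso X Y Z, CBimod.assocIso_apply X Y Z⟩,
    fun X => ⟨CBimod.isUnitary_leftUnitorIso X,
      fun b hb ζ ξ => RelTensor.leftUnitor_tmul X.left ⟨b, hb⟩ ζ ξ⟩,
    fun X => ⟨CBimod.isUnitary_rightUnitorIso X,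
      fun ξ ζ b hb => RelTensor.rightUnitor_tmul X.right ξ ζ ⟨b, hb⟩⟩,
    CBimod.monoidalCategory 𝔅, rfl⟩
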